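/- Let $\hbar>0$. For a complex symmetric $2\times2$ matrix $K$ (an "expression parameter") let $*_K$ be the product on functions of $\boldsymbol u=(u_1,u_2)\in\mathbb C^2$ given by $$p*_Kf=p\,\exp\Big(\tfrac{i\hbar}{2}\sum_{i,j}\overleftarrow{\partial_i}\,(K+J)_{ij}\,\overrightarrow{\partial_j}\Big)f ,\qquad J=\begin{pmatrix}0&-1\\1&0\end{pmatrix},$$ for polynomials $p$ and entire functions $f$. For $g\in SL(2,\mathbb C)$ put $\langle\boldsymbol ug,\boldsymbol ug\rangle_*=\sum_k(\boldsymbol ug)_k*(\boldsymbol ug)_k$. The $K$-ordered expression $F_t={:}e_*^{\frac{t}{i\hbar}\langle\boldsymbol ug,\boldsymbol ug\rangle_*}{:}_K$ is the (multivalued) analytic function of $t\in\mathbb C$ obtained by continuing analytically, along paths starting at $t=0$, the solution, holomorphic in $(t,\boldsymbol u)$ and entire in $\boldsymbol u$, of $$\partial_tF_t=\tfrac1{i\hbar}\langle\boldsymbol ug,\boldsymbol ug\rangle_* *_K F_t,\qquad F_0=1 .$$ A point $t_0\in\mathbb C$ is a *singular point* if there is a path from $0$ to $t_0$ along which $F_t$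 can be continued up to, but not including, the end point $t_0$. The value $e_*^{\frac{\pi}{i\hbar}\langle\boldsymbol ug,\boldsymbol ug\rangle_*}$ is the one obtained by continuation along the real segment $[0,\pi]$. A *line of singular points* is a line parallel to the real axis that carries singular points, distributed $\pi$-periodically along it. Let $\tilde S^2$ be the set of symmetric elements of $SU(2)$, and $\mathcal S'=\{g\in SL(2,\mathbb C):g\,{}^t\!g\in\tilde S^2\}$, with the topology induced from $SL(2,\mathbb C)$. **Theorem.** For generic $K$, that is, for all $K$ in some dense open subset of the space of complex symmetric $2\times 2$ matrices, there are three nonempty, pairwise disjoint subsets $S_0,S_+,S_-$ of $\mathcal S'$, open in $\mathcal S'$, with $\overline{S_0\cup S_+\cup S_-}=\mathcal S'$, such that for every $g\in\mathcal S'$: * $g\in S_0$ if and only if $e_*^{\frac{\pi}{i\hbar}\langle\boldsymbol ug,\boldsymbol ug\rangle_*}=1$ and the singular points lie on two lines of singular points, one in the open upper and one in the open lower half-plane, so that the real axis is between them; * $g\in S_+$ if and only if $e_*^{\frac{\pi}{i\hbar}\langle\boldsymbol ug,\boldsymbol ug\rangle_*}=-1$, and there are singular points and all of them lie in the open upper half-plane;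 * $g\in S_-$ if and only if $e_*^{\frac{\pi}{i\hbar}\langle\boldsymbol ug,\boldsymbol ug\rangle_*}=-1$, and there are singular points and all of them lie in the open lower half-plane. -/

import Mathlib

namespace WeylStar

open Matrix Set Filter Topology

noncomputable section

/-- A function of the generators `𝒖 = (u₁, u₂) = (u, v)`, regarded as complex variables. -/
abbrev Symbol : Type := (Fin 2 → ℂ) → ℂ

/-- The skew part `J` of the product; it gives `[u, v]_* = -iħ`. -/
def J : Matrix (Fin 2) (Fin 2) ℂ := !![0, -1; 1, 0]

/-- The `K`-ordered product `uᵢ *_K f`. For a left factor of degree one the product formula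
`p *_K f = p exp ((iħ/2) ∑ ←∂ᵢ Λᵢⱼ →∂ⱼ) f`, with `Λ = K + J`, has only the two terms
`uᵢ f + (iħ/2) ∑ⱼ Λᵢⱼ ∂ⱼ f`. -/
def genStar (ħ : ℝ) (K : Matrix (Fin 2) (Fin 2) ℂ) (i : Fin 2) (f : Symbol) : Symbol :=
  fun u => u i * f u +
    (Complex.I * (ħ : ℂ) / 2) * ∑ j, (K + J) i j * fderiv ℂ f u (Pi.single j 1)

/-- `(𝒖g)ₖ *_K f`, where `(𝒖g)ₖ = ∑ᵢ uᵢ gᵢₖ`. -/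
def linStar (ħ : ℝ) (K g : Matrix (Fin 2) (Fin 2) ℂ) (k : Fin 2) (f : Symbol) : Symbol :=
  fun u => ∑ i, g i k * genStar ħ K i f u

/-- `⟨𝒖g, 𝒖g⟩_* *_K f`, where `⟨𝒖g, 𝒖g⟩_* = ∑ₖ (𝒖g)ₖ * (𝒖g)ₖ`. By associativity of the product
the left factors act one after the other. -/
def quadStar (ħ : ℝ) (K g : Matrix (Fin 2) (Fin 2) ℂ) (f : Symbol) : Symbol :=
  fun u => ∑ k, linStar ħ K g k (linStar ħ K g k f) u

/-- `F` is, for `t` near `t₀`, a holomorphic solution (entire in `𝒖`) of the evolution equation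
`∂ₜ F = (1/(iħ)) ⟨𝒖g, 𝒖g⟩_* *_K F` that defines the `*`-exponential function. -/
def IsLocalSolution (ħ : ℝ) (K g : Matrix (Fin 2) (Fin 2) ℂ) (t₀ : ℂ) (F : ℂ → Symbol) : Prop :=
  ∃ V : Set ℂ, IsOpen V ∧ t₀ ∈ V ∧
    DifferentiableOn ℂ (fun p : ℂ × (Fin 2 → ℂ) => F p.1 p.2) (V ×ˢ univ) ∧
    ∀ t ∈ V, ∀ u : Fin 2 → ℂ,
      deriv (fun s => F s u) t = (1 / (Complex.I * (ħ : ℂ))) * quadStar ħ K g (F t) u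

/-- `Φ` is the analytic continuation, along the part `γ|_I` of a path `γ` that starts at `γ 0 = 0`,
of the `K`-ordered expression of `e_*^{(t/(iħ)) ⟨𝒖g, 𝒖g⟩_*}`, which has the value `1` at `t = 0`.
Here `Φ s` is the function element in `t` at the point `γ s`. -/
structure IsContinuationAlong (ħ : ℝ) (K g : Matrix (Fin 2) (Fin 2) ℂ) (γ : ℝ → ℂ) (I : Set ℝ)
    (Φ : ℝ → ℂ → Symbol) : Prop where
  initial : ∀ u, Φ 0 0 u = 1
  solves : ∀ s ∈ I, IsLocalSolution ħ K g (γ s) (Φ s)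
  compatible : ∀ s ∈ I, ∀ᶠ s' in 𝓝[I] s, ∀ᶠ t in 𝓝 (γ s'), Φ s' t = Φ s t

/-- `:e_*^{[0→t] (1/(iħ)) ⟨𝒖g, 𝒖g⟩_*}:_K = f`: the continuation along the straight segment
from `0` to `t` exists, and its value at `t` is the function `f` of `𝒖`. -/
def StarExpEq (ħ : ℝ) (K g : Matrix (Fin 2) (Fin 2) ℂ) (t : ℂ) (f : Symbol) : Prop :=
  ∃ Φ : ℝ → ℂ → Symbol,
    IsContinuationAlong ħ K g (fun s => (s : ℂ) * t) (Icc 0 1) Φ ∧ Φ 1 t = f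

/-- The singular points, in the complex `t`-plane, of the (multivalued) analytic function
`t ↦ :e_*^{(t/(iħ)) ⟨𝒖g, 𝒖g⟩_*}:_K`: the points `t₀` that are the end of a path from `0` along which
the function can be continued up to, but not including, the end. -/
def singularPoints (ħ : ℝ) (K g : Matrix (Fin 2) (Fin 2) ℂ) : Set ℂ :=
  {t₀ | ∃ γ : ℝ → ℂ, Continuous γ ∧ γ 0 = 0 ∧ γ 1 = t₀ ∧
    (∃ Φ, IsContinuationAlong ħ K g γ (Ico 0 1) Φ) ∧
    ¬ ∃ Φ, IsContinuationAlong ħ K g γ (Icc 0 1) Φ}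

/-- The line `Im t = c` is a line of singular points: it carries singular points, and these are
distributed `π`-periodically along it. -/
def IsSingularLine (ħ : ℝ) (K g : Matrix (Fin 2) (Fin 2) ℂ) (c : ℝ) : Prop :=
  (∃ t ∈ singularPoints ħ K g, t.im = c) ∧
  ∀ t ∈ singularPoints ħ K g, t.im = c →
    t + (Real.pi : ℂ) ∈ singularPoints ħ K g ∧ t - (Real.pi : ℂ) ∈ singularPoints ħ K g

/-- All singular points lie on two lines of singular points, parallel to the real axis, and the
real axis is between these. -/
def RealAxisBetweenSingularLines (ħ : ℝ) (K g : Matrix (Fin 2) (Fin 2) ℂ) : Prop :=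
  ∃ a b : ℝ, a < 0 ∧ 0 < b ∧ IsSingularLine ħ K g a ∧ IsSingularLine ħ K g b ∧
    ∀ t ∈ singularPoints ħ K g, t.im = a ∨ t.im = b

/-- There are singular points, and all of them are in the open upper half-plane. -/
def SingularPointsInUpper (ħ : ℝ) (K g : Matrix (Fin 2) (Fin 2) ℂ) : Prop :=
  (singularPoints ħ K g).Nonempty ∧ ∀ t ∈ singularPoints ħ K g, 0 < t.im

/-- There are singular points, and all of them are in the open lower half-plane. -/
def SingularPointsInLower (ħ : ℝ) (K g : Matrix (Fin 2) (Fin 2) ℂ) : Prop :=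
  (singularPoints ħ K g).Nonempty ∧ ∀ t ∈ singularPoints ħ K g, t.im < 0

/-- `S̃²`, the set of symmetric elements of `SU(2)`. -/
def sphere : Set (Matrix (Fin 2) (Fin 2) ℂ) :=
  {P | P ∈ Matrix.specialUnitaryGroup (Fin 2) ℂ ∧ P.IsSymm}

/-- `𝒮' = {g ∈ SL(2, ℂ) ; g ᵗg ∈ S̃²}`. -/
def SPrime : Set (Matrix.SpecialLinearGroup (Fin 2) ℂ) :=
  {g | (g : Matrix (Fin 2) (Fin 2) ℂ) * (g : Matrix (Fin 2) (Fin 2) ℂ)ᵀ ∈ sphere}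

/-- The space of expression parameters: all complex symmetric `2 × 2` matrices. -/
abbrev ExprParam : Type := {K : Matrix (Fin 2) (Fin 2) ℂ // K.IsSymm}

end

end WeylStar

/-! Put P = g ᵗg, a symmetric matrix of determinant 1. The evolution equation is solved by a
Gaussian in 𝒖 with exponent `expo / disc` and amplitude `disc ^ (-1/2)`, where `disc` is det(cos t -
sin t KP). Holomorphic solutions are unique, because all Taylor coefficients in t are determined by
the value at one time, so every continuation consists of such Gaussians. Since amplitude² · `disc` =
1 persists along a path, no continuation reaches a zero of `disc`. Conversely, a logarithm of `disc`
along a path that avoids its zeros yields a continuation. Hence the singular points are exactly the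
zeros of `disc` (`singularPoints_eq`).

If κ₁, κ₂ are the eigenvalues of KP, then `disc` = ∏ (cos t - κⱼ sin t). The zeros of one factor
solve cot t = κ: they form one π-periodic orbit on a horizontal line, with Im t of the sign opposite
to Im κ. There are none if κ = ±i, when the factor is e^{∓it}. A real κ gives a zero on [0, π].
Otherwise the factor runs from 1 to -1 through one half-plane, and its square root ends at eⱼ i with
eⱼ = -sign Im κⱼ. As sin π = 0, the value at π is the constant 1/(e₁i · e₂i) = -e₁e₂. So the three
cases of the theorem are the sign patterns of (Im κ₁, Im κ₂), up to the exceptional values ±i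
(`between_iff`, `upper_iff`, `lower_iff`).

These patterns depend only on τ = tr(KP) and δ = det K. If Im δ ≠ 0, which is the genericity
condition, then `rootDisc δ τ` has the sign of -Im κ₁ Im κ₂, the sign of Im τ separates the two
remaining cases, and some κⱼ = ±i iff τ² + (1 - δ)² = 0. These are open conditions on g. For
nonemptiness, P runs over a 2-sphere on which τ is real-linear, and it takes the values 0 and ±2√δ
there. For density, P is joined by a great circle, lifted to 𝒮', to a point with τ = 0. The bad set
is the zero set of a real polynomial in (Re τ, Im τ) that is nonzero at τ = 0, so by analyticity it
contains no neighbourhood of the starting point on the curve. -/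

section SeveralComplexVariables

/-! ### Smoothness of holomorphic functions of several variables -/

open Metric Set Filter Topology

variable {E : Type*} [NormedAddCommGroup E] [NormedSpace ℂ E]

/-- Cauchy's estimate for the derivative of a bounded holomorphic function on a ball. -/
theorem norm_fderiv_le_of_differentiableOn_ball {f : E → ℂ} {x : E} {r M : ℝ} (hr : 0 < r)
    (hf : DifferentiableOn ℂ f (ball x (2 * r))) (hM : ∀ y ∈ ball x (2 * r), ‖f y‖ ≤ M) :
    ‖fderiv ℂ f x‖ ≤ M / r := by
  have hM0 : 0 ≤ M := (norm_nonneg _).trans (hM x (mem_ball_self (by positivity)))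
  refine ContinuousLinearMap.opNorm_le_bound _ (by positivity) fun w => ?_
  rcases eq_or_ne w 0 with rfl | hw
  · simp
  have hw' : 0 < ‖w‖ := norm_pos_iff.2 hw
  -- The estimate is Cauchy's in one variable on the complex line x + z w. The radius in z is scaled
  -- so that the displacement z w has norm at most r.
  set ρ : ℝ := r / ‖w‖ with hρ
  have hρ0 : 0 < ρ := by positivity
  have hline : ∀ z ∈ closedBall (0 : ℂ) ρ, x + z • w ∈ ball x (2 * r) := by
    intro z hz
    rw [mem_closedBall_zero_iff] at hz
    rw [mem_ball_iff_norm, add_sub_cancel_left, norm_smul]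
    have : ‖z‖ * ‖w‖ ≤ ρ * ‖w‖ := by gcongr
    rw [hρ, div_mul_cancel₀ _ hw'.ne'] at this
    linarith
  have hg : DifferentiableOn ℂ (fun z : ℂ => f (x + z • w)) (closedBall 0 ρ) :=
    hf.comp (by fun_prop) hline
  have hd := Complex.norm_deriv_le_of_forall_mem_sphere_norm_le hρ0
    (hg.mono closure_ball_subset_closedBall).diffContOnCl
    (fun z hz => hM _ (hline z (sphere_subset_closedBall hz)))
  have hx : HasFDerivAt f (fderiv ℂ f x) (x + (0 : ℂ) • w) := by
    rw [zero_smul, add_zero]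
    exact (hf.differentiableAt (ball_mem_nhds _ (by positivity))).hasFDerivAt
  have hderiv : HasDerivAt (fun z : ℂ => f (x + z • w)) (fderiv ℂ f x w) 0 := by
    have h1 : HasDerivAt (fun z : ℂ => x + z • w) ((1 : ℂ) • w) 0 :=
      ((hasDerivAt_id (0 : ℂ)).smul_const w).const_add x
    rw [one_smul] at h1
    exact hx.comp_hasDerivAt (0 : ℂ) h1
  rw [hderiv.deriv] at hd
  calc _ ≤ M / ρ := hd
    _ = M / r * ‖w‖ := by rw [hρ]; field_simp

variable [FiniteDimensional ℂ E]

/-- Directional derivatives of a holomorphic function are holomorphic. -/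
theorem DifferentiableOn.fderiv_apply_of_isOpen {f : E → ℂ} {U : Set E} (hU : IsOpen U)
    (hf : DifferentiableOn ℂ f U) (v : E) :
    DifferentiableOn ℂ (fun x => fderiv ℂ f x v) U := by
  intro x₀ hx₀
  refine DifferentiableAt.differentiableWithinAt ?_
  have : ProperSpace E := FiniteDimensional.proper ℂ E
  borelize E
  -- Radius 4r leaves room for the ball of radius 2r about any point of the ball of radius 2r, so
  -- that Cauchy's estimate bounds `fderiv` uniformly on the smaller ball.
  obtain ⟨r, hr, hrU, M, hM⟩ : ∃ r > 0, ball x₀ (4 * r) ⊆ U ∧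
      ∃ M, ∀ y ∈ ball x₀ (4 * r), ‖f y‖ ≤ M := by
    have h1 : ∀ᶠ y in 𝓝 x₀, y ∈ U ∧ ‖f y‖ ≤ ‖f x₀‖ + 1 := by
      have hc : ContinuousAt f x₀ := (hf.differentiableAt (hU.mem_nhds hx₀)).continuousAt
      exact (hU.eventually_mem hx₀).and
        ((hc.norm.eventually_lt continuousAt_const (lt_add_one _)).mono fun _ h => h.le)
    obtain ⟨ε, hε, h⟩ := Metric.eventually_nhds_iff_ball.1 h1
    refine ⟨ε / 4, by positivity, fun y hy => (h y ?_).1, _, fun y hy => (h y ?_).2⟩ <;>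
    · convert hy using 2
      ring
  set ρ : ℝ := r / (‖v‖ + 1) with hρ
  have hρ0 : 0 < ρ := by positivity
  have hρv : ρ * ‖v‖ ≤ r := by
    rw [hρ, div_mul_eq_mul_div, div_le_iff₀ (by positivity)]
    nlinarith [norm_nonneg v]
  have hline : ∀ x ∈ ball x₀ r, ∀ z ∈ closedBall (0 : ℂ) ρ, x + z • v ∈ ball x₀ (2 * r) := by
    intro x hx z hz
    rw [mem_closedBall_zero_iff] at hz
    rw [mem_ball_iff_norm] at hx ⊢
    have h1 : ‖z • v‖ ≤ r := by
      rw [norm_smul]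
      exact (mul_le_mul_of_nonneg_right hz (norm_nonneg _)).trans hρv
    calc ‖x + z • v - x₀‖ = ‖(x - x₀) + z • v‖ := by congr 1; abel
      _ ≤ ‖x - x₀‖ + ‖z • v‖ := norm_add_le _ _
      _ < 2 * r := by linarith
  have h24 : ball x₀ (2 * r) ⊆ ball x₀ (4 * r) := ball_subset_ball (by linarith)
  have hdiff : ∀ y ∈ ball x₀ (2 * r), DifferentiableAt ℂ f y := fun y hy =>
    hf.differentiableAt (hU.mem_nhds (hrU (h24 hy)))
  have hbound : ∀ y ∈ ball x₀ (2 * r), ‖fderiv ℂ f y‖ ≤ M / r := by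
    intro y hy
    have hsub : ball y (2 * r) ⊆ ball x₀ (4 * r) := by
      apply ball_subset_ball'
      rw [mem_ball] at hy
      linarith
    exact norm_fderiv_le_of_differentiableOn_ball hr (hf.mono (hsub.trans hrU))
      fun w hw => hM w (hsub hw)
  have hmem : ∀ θ : ℝ, circleMap 0 ρ θ ∈ closedBall (0 : ℂ) ρ := fun θ =>
    circleMap_mem_closedBall _ hρ0.le _
  set w : ℝ → ℂ := fun θ => _root_.deriv (circleMap 0 ρ) θ * (1 / (circleMap 0 ρ θ - 0) ^ 2) with hw
  have hwc : Continuous w := by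
    have : ∀ θ, (circleMap 0 ρ θ - 0) ^ 2 ≠ 0 := fun θ => by
      simp [circleMap, hρ0.ne']
    simp only [hw, deriv_circleMap]
    exact ((continuous_circleMap 0 ρ).mul continuous_const).mul
      (continuous_const.div (((continuous_circleMap 0 ρ).sub continuous_const).pow 2) this)
  -- Cauchy's integral formula for the derivative along v, with one circle for all x near x₀. The
  -- right-hand side can then be differentiated in x under the integral sign.
  have hformula : ∀ x ∈ ball x₀ r,
      ∫ θ in (0 : ℝ)..2 * Real.pi, w θ * f (x + circleMap 0 ρ θ • v) =
        (2 * Real.pi * Complex.I) * fderiv ℂ f x v := by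
    intro x hx
    have hg : DifferentiableOn ℂ (fun z : ℂ => f (x + z • v)) (closedBall 0 ρ) :=
      fun z hz => ((hdiff _ (hline x hx z hz)).comp z (by fun_prop)).differentiableWithinAt
    have h := hg.deriv_eq_smul_circleIntegral hρ0
    have hx' : HasFDerivAt f (fderiv ℂ f x) (x + (0 : ℂ) • v) := by
      rw [zero_smul, add_zero]
      exact (hdiff x (ball_subset_ball (by linarith) hx)).hasFDerivAt
    have hderiv : HasDerivAt (fun z : ℂ => f (x + z • v)) (fderiv ℂ f x v) 0 := by
      have h1 : HasDerivAt (fun z : ℂ => x + z • v) ((1 : ℂ) • v) 0 :=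
        ((hasDerivAt_id (0 : ℂ)).smul_const v).const_add x
      rw [one_smul] at h1
      exact hx'.comp_hasDerivAt (0 : ℂ) h1
    rw [hderiv.deriv] at h
    simpa [circleIntegral, hw, mul_assoc] using h
  have hcont : ∀ x ∈ ball x₀ r, Continuous fun θ : ℝ => w θ * f (x + circleMap 0 ρ θ • v) := by
    intro x hx
    refine hwc.mul (continuous_iff_continuousAt.2 fun θ => ?_)
    have h1 : ContinuousAt f (x + circleMap 0 ρ θ • v) :=
      (hdiff _ (hline x hx _ (hmem θ))).continuousAt
    exact h1.comp (f := fun θ : ℝ => x + circleMap 0 ρ θ • v) (by fun_prop)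
  have key := intervalIntegral.hasFDerivAt_integral_of_dominated_of_fderiv_le (𝕜 := ℂ)
    (μ := MeasureTheory.volume) (a := 0) (b := 2 * Real.pi) (x₀ := x₀) (s := ball x₀ r)
    (F := fun x θ => w θ * f (x + circleMap 0 ρ θ • v))
    (F' := fun x θ => w θ • fderiv ℂ f (x + circleMap 0 ρ θ • v))
    (bound := fun θ => ‖w θ‖ * (M / r)) (ball_mem_nhds _ hr)
    (by
      filter_upwards [ball_mem_nhds x₀ hr] with x hx
      exact (hcont x hx).aestronglyMeasurable)
    ((hcont x₀ (mem_ball_self hr)).intervalIntegrable _ _)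
    (by
      have h1 : Measurable (fun θ : ℝ => fderiv ℂ f (x₀ + circleMap 0 ρ θ • v)) :=
        (measurable_fderiv ℂ f).comp (by fun_prop : Continuous _).measurable
      exact (hwc.measurable.smul h1).aestronglyMeasurable)
    (Eventually.of_forall fun θ _ x hx => by
      rw [norm_smul]
      exact mul_le_mul_of_nonneg_left (hbound _ (hline x hx _ (hmem θ))) (norm_nonneg _))
    ((hwc.norm.mul continuous_const).intervalIntegrable _ _)
    (Eventually.of_forall fun θ _ x hx => by
      have h1 := (hdiff _ (hline x hx _ (hmem θ))).hasFDerivAt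
      have h2 : HasFDerivAt (fun x : E => f (x + circleMap 0 ρ θ • v))
          (fderiv ℂ f (x + circleMap 0 ρ θ • v)) x :=
        h1.comp x ((hasFDerivAt_id x).add_const _)
      exact h2.const_mul (w θ))
  have hev : (fun x => fderiv ℂ f x v) =ᶠ[𝓝 x₀] fun x => (2 * Real.pi * Complex.I)⁻¹ *
      ∫ θ in (0 : ℝ)..2 * Real.pi, w θ * f (x + circleMap 0 ρ θ • v) := by
    filter_upwards [ball_mem_nhds x₀ hr] with x hx
    rw [hformula x hx, inv_mul_cancel_left₀]
    simp [Real.pi_ne_zero]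
  exact (key.differentiableAt.const_mul _).congr_of_eventuallyEq hev

/-- Holomorphic functions of several variables are smooth. -/
theorem DifferentiableOn.contDiffOn_of_isOpen {f : E → ℂ} {U : Set E} (hU : IsOpen U)
    (hf : DifferentiableOn ℂ f U) (n : ℕ) : ContDiffOn ℂ n f U := by
  induction n generalizing f with
  | zero => exact contDiffOn_zero.2 hf.continuousOn
  | succ n ih =>
    have h := contDiffOn_succ_of_fderiv_apply (n := (n : WithTop ℕ∞)) hf (fun h => by simp at h)
      fun v => (ih (hf.fderiv_apply_of_isOpen hU v)).congr fun x hx => by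
        rw [fderivWithin_of_isOpen hU hx]
    exact_mod_cast h

end SeveralComplexVariables

/-! ### Families of entire functions depending holomorphically on time -/

namespace WeylStar

open Matrix Set Filter Topology

noncomputable section

/-- `(t, u) ↦ F t u` is holomorphic on `V × ℂ²`. -/
def HolOn (V : Set ℂ) (F : ℂ → Symbol) : Prop :=
  DifferentiableOn ℂ (fun p : ℂ × (Fin 2 → ℂ) => F p.1 p.2) (V ×ˢ univ)

/-- The derivative in `t`. -/
def timeDeriv (F : ℂ → Symbol) : ℂ → Symbol := fun t u => deriv (fun s => F s u) t

section HolOn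

variable {V : Set ℂ} {F G : ℂ → Symbol}

theorem isOpen_prod_univ (hV : IsOpen V) : IsOpen (V ×ˢ (univ : Set (Fin 2 → ℂ))) :=
  hV.prod isOpen_univ

theorem HolOn.differentiableAt (hF : HolOn V F) (hV : IsOpen V) {t : ℂ} (ht : t ∈ V)
    (u : Fin 2 → ℂ) : DifferentiableAt ℂ (fun p : ℂ × (Fin 2 → ℂ) => F p.1 p.2) (t, u) :=
  DifferentiableOn.differentiableAt hF ((isOpen_prod_univ hV).mem_nhds ⟨ht, mem_univ _⟩)

theorem HolOn.hasDerivAt (hF : HolOn V F) (hV : IsOpen V) {t : ℂ} (ht : t ∈ V) (u : Fin 2 → ℂ) :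
    HasDerivAt (fun s => F s u)
      (fderiv ℂ (fun p : ℂ × (Fin 2 → ℂ) => F p.1 p.2) (t, u) (1, 0)) t := by
  have h1 : HasDerivAt (fun s : ℂ => (s, u)) ((1 : ℂ), (0 : Fin 2 → ℂ)) t :=
    (hasDerivAt_id t).prodMk (hasDerivAt_const t u)
  exact (hF.differentiableAt hV ht u).hasFDerivAt.comp_hasDerivAt t h1

theorem HolOn.hasFDerivAt (hF : HolOn V F) (hV : IsOpen V) {t : ℂ} (ht : t ∈ V) (u : Fin 2 → ℂ) :
    HasFDerivAt (F t) ((fderiv ℂ (fun p : ℂ × (Fin 2 → ℂ) => F p.1 p.2) (t, u)).comp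
      (ContinuousLinearMap.inr ℂ ℂ (Fin 2 → ℂ))) u := by
  have h1 : HasFDerivAt (fun v : Fin 2 → ℂ => (t, v))
      (ContinuousLinearMap.inr ℂ ℂ (Fin 2 → ℂ)) u := hasFDerivAt_prodMk_right t u
  exact (hF.differentiableAt hV ht u).hasFDerivAt.comp u h1

theorem HolOn.differentiable (hF : HolOn V F) (hV : IsOpen V) {t : ℂ} (ht : t ∈ V) :
    Differentiable ℂ (F t) := fun u => (hF.hasFDerivAt hV ht u).differentiableAt

theorem HolOn.differentiableOn_time (hF : HolOn V F) (hV : IsOpen V) (u : Fin 2 → ℂ) :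
    DifferentiableOn ℂ (fun s => F s u) V := fun _ ht =>
  (hF.hasDerivAt hV ht u).differentiableAt.differentiableWithinAt

theorem HolOn.timeDeriv_eq (hF : HolOn V F) (hV : IsOpen V) {t : ℂ} (ht : t ∈ V)
    (u : Fin 2 → ℂ) : timeDeriv F t u =
      fderiv ℂ (fun p : ℂ × (Fin 2 → ℂ) => F p.1 p.2) (t, u) (1, 0) :=
  (hF.hasDerivAt hV ht u).deriv

theorem HolOn.fderiv_single_eq (hF : HolOn V F) (hV : IsOpen V) {t : ℂ} (ht : t ∈ V)
    (u v : Fin 2 → ℂ) : fderiv ℂ (F t) u v =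
      fderiv ℂ (fun p : ℂ × (Fin 2 → ℂ) => F p.1 p.2) (t, u) (0, v) := by
  rw [(hF.hasFDerivAt hV ht u).fderiv]
  rfl

theorem HolOn.timeDeriv (hF : HolOn V F) (hV : IsOpen V) : HolOn V (timeDeriv F) :=
  (DifferentiableOn.fderiv_apply_of_isOpen (isOpen_prod_univ hV) hF (1, 0)).congr
    fun p hp => hF.timeDeriv_eq hV hp.1 p.2

theorem HolOn.fderiv_apply (hF : HolOn V F) (hV : IsOpen V) (v : Fin 2 → ℂ) :
    HolOn V (fun t u => fderiv ℂ (F t) u v) :=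
  (DifferentiableOn.fderiv_apply_of_isOpen (isOpen_prod_univ hV) hF (0, v)).congr
    fun p hp => hF.fderiv_single_eq hV hp.1 p.2 v

/-- Symmetry of the second derivative in (t, 𝒖), available because a holomorphic function is C². -/
theorem HolOn.timeDeriv_fderiv_apply (hF : HolOn V F) (hV : IsOpen V) {t : ℂ} (ht : t ∈ V)
    (u v : Fin 2 → ℂ) : WeylStar.timeDeriv (fun s w => fderiv ℂ (F s) w v) t u =
      fderiv ℂ (WeylStar.timeDeriv F t) u v := by
  set f : ℂ × (Fin 2 → ℂ) → ℂ := fun p => F p.1 p.2 with hf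
  have hO := (isOpen_prod_univ hV).mem_nhds (⟨ht, mem_univ u⟩ : (t, u) ∈ V ×ˢ univ)
  have hc : ContDiffAt ℂ 2 f (t, u) :=
    (DifferentiableOn.contDiffOn_of_isOpen (isOpen_prod_univ hV) hF 2).contDiffAt hO
  have hd : DifferentiableAt ℂ (fderiv ℂ f) (t, u) :=
    (hc.fderiv_right (m := 1) (by norm_num)).differentiableAt (by norm_num)
  have hsymm : IsSymmSndFDerivAt ℂ f (t, u) := hc.isSymmSndFDerivAt (by simp)
  have happ : ∀ a b : ℂ × (Fin 2 → ℂ), fderiv ℂ (fun p => fderiv ℂ f p a) (t, u) b =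
      fderiv ℂ (fderiv ℂ f) (t, u) b a := by
    intro a b
    rw [fderiv_clm_apply hd (by fun_prop)]
    simp
  have e1 : (fun p : ℂ × (Fin 2 → ℂ) => fderiv ℂ (F p.1) p.2 v) =ᶠ[𝓝 (t, u)]
      fun p => fderiv ℂ f p (0, v) := by
    filter_upwards [hO] with p hp using hF.fderiv_single_eq hV hp.1 p.2 v
  have e2 : (fun p : ℂ × (Fin 2 → ℂ) => WeylStar.timeDeriv F p.1 p.2) =ᶠ[𝓝 (t, u)]
      fun p => fderiv ℂ f p (1, 0) := by
    filter_upwards [hO] with p hp using hF.timeDeriv_eq hV hp.1 p.2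
  rw [(hF.fderiv_apply hV v).timeDeriv_eq hV ht, (hF.timeDeriv hV).fderiv_single_eq hV ht,
    e1.fderiv_eq, e2.fderiv_eq, happ, happ]
  exact hsymm.eq _ _

theorem HolOn.sub (hF : HolOn V F) (hG : HolOn V G) : HolOn V (fun t => F t - G t) :=
  DifferentiableOn.sub hF hG

theorem HolOn.mono {W : Set ℂ} (hF : HolOn V F) (h : W ⊆ V) : HolOn W F :=
  DifferentiableOn.mono hF (prod_mono h Subset.rfl)

end HolOn

/-! ### Operators commuting with the time derivative, and uniqueness of solutions -/

/-- Linear operators on entire functions that respect holomorphic dependence on a parameter. -/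
structure IsHolOperator (T : Symbol → Symbol) : Prop where
  differentiable : ∀ f, Differentiable ℂ f → Differentiable ℂ (T f)
  map_sub : ∀ f g, Differentiable ℂ f → Differentiable ℂ g → T (f - g) = T f - T g
  holOn : ∀ V F, IsOpen V → HolOn V F → HolOn V (fun t => T (F t))
  timeDeriv : ∀ V F, IsOpen V → HolOn V F → ∀ t ∈ V,
    timeDeriv (fun s => T (F s)) t = T (timeDeriv F t)

theorem IsHolOperator.map_zero {T : Symbol → Symbol} (hT : IsHolOperator T) : T 0 = 0 := by
  have h0 : Differentiable ℂ (0 : Symbol) := differentiable_const (0 : ℂ)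
  simpa using hT.map_sub 0 0 h0 h0

theorem IsHolOperator.comp {S T : Symbol → Symbol} (hS : IsHolOperator S)
    (hT : IsHolOperator T) : IsHolOperator (fun f => S (T f)) where
  differentiable f hf := hS.differentiable _ (hT.differentiable f hf)
  map_sub f g hf hg := by
    rw [hT.map_sub f g hf hg, hS.map_sub _ _ (hT.differentiable f hf) (hT.differentiable g hg)]
  holOn V F hV hF := hS.holOn V _ hV (hT.holOn V F hV hF)
  timeDeriv V F hV hF t ht := by
    rw [hS.timeDeriv V _ hV (hT.holOn V F hV hF) t ht, hT.timeDeriv V F hV hF t ht]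

theorem IsHolOperator.sum_smul {ι : Type*} [Fintype ι] {T : ι → Symbol → Symbol} (c : ι → ℂ)
    (hT : ∀ i, IsHolOperator (T i)) : IsHolOperator (fun f u => ∑ i, c i * T i f u) where
  differentiable f hf := Differentiable.fun_sum fun i _ => ((hT i).differentiable f hf).const_mul _
  map_sub f g hf hg := by
    ext u
    simp [(hT _).map_sub f g hf hg, mul_sub]
  holOn V F hV hF :=
    DifferentiableOn.fun_sum fun i _ => DifferentiableOn.const_mul ((hT i).holOn V F hV hF) _
  timeDeriv V F hV hF t ht := by
    ext u
    have h : ∀ i, DifferentiableAt ℂ (fun s => T i (F s) u) t := fun i =>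
      (((hT i).holOn V F hV hF).hasDerivAt hV ht u).differentiableAt
    have h2 : ∀ i, deriv (fun s => T i (F s) u) t = T i (WeylStar.timeDeriv F t) u := fun i =>
      congrFun ((hT i).timeDeriv V F hV hF t ht) u
    simp only [WeylStar.timeDeriv] at h2 ⊢
    rw [deriv_fun_sum fun i _ => (h i).const_mul _]
    simp [deriv_const_mul _ (h _), h2]

theorem isHolOperator_coord (i : Fin 2) : IsHolOperator (fun f u => u i * f u) where
  differentiable f hf := (differentiable_apply i).mul hf
  map_sub f g _ _ := by
    ext u
    simp [mul_sub]
  holOn V F hV hF := DifferentiableOn.mul (by fun_prop) hF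
  timeDeriv V F hV hF t ht := by
    ext u
    exact deriv_const_mul _ (hF.hasDerivAt hV ht u).differentiableAt

theorem isHolOperator_fderiv (v : Fin 2 → ℂ) : IsHolOperator (fun f u => fderiv ℂ f u v) where
  differentiable f hf :=
    differentiableOn_univ.1 (hf.differentiableOn.fderiv_apply_of_isOpen isOpen_univ v)
  map_sub f g hf hg := by
    ext u
    simp [fderiv_sub (hf u) (hg u)]
  holOn V F hV hF := hF.fderiv_apply hV v
  timeDeriv V F hV hF t ht := by
    ext u
    exact hF.timeDeriv_fderiv_apply hV ht u v

variable (ħ : ℝ) (K g : Matrix (Fin 2) (Fin 2) ℂ)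

theorem isHolOperator_genStar (i : Fin 2) : IsHolOperator (genStar ħ K i) := by
  have h1 := IsHolOperator.sum_smul (fun j => (K + J) i j)
    fun j => isHolOperator_fderiv (Pi.single j (1 : ℂ))
  have h2 := IsHolOperator.sum_smul (T := ![fun f u => u i * f u,
    fun f u => ∑ j, (K + J) i j * fderiv ℂ f u (Pi.single j 1)])
    ![1, Complex.I * (ħ : ℂ) / 2] (by
      intro k
      fin_cases k
      · exact isHolOperator_coord i
      · exact h1)
  convert h2 using 3
  simp [genStar]

theorem isHolOperator_linStar (k : Fin 2) : IsHolOperator (linStar ħ K g k) :=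
  IsHolOperator.sum_smul (fun i => g i k) fun i => isHolOperator_genStar ħ K i

theorem isHolOperator_quadStar : IsHolOperator (quadStar ħ K g) := by
  have h := IsHolOperator.sum_smul (fun _ => 1) fun k =>
    (isHolOperator_linStar ħ K g k).comp (isHolOperator_linStar ħ K g k)
  convert h using 3
  simp [quadStar]

variable {ħ K g}

/-- Since T commutes with ∂ₜ, the time derivative of a solution is again a solution, and by the
equation it too vanishes at t₀. The induction therefore has to generalize over F. -/
theorem IsHolOperator.iteratedDeriv_eq_zero {T : Symbol → Symbol} (hT : IsHolOperator T) {V : Set ℂ}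
    (hV : IsOpen V) {t₀ c : ℂ} (ht₀ : t₀ ∈ V) (n : ℕ) {F : ℂ → Symbol} (hF : HolOn V F)
    (h0 : F t₀ = 0) (heq : ∀ t ∈ V, ∀ u, deriv (fun s => F s u) t = c * T (F t) u)
    (u : Fin 2 → ℂ) : iteratedDeriv n (fun s => F s u) t₀ = 0 := by
  induction n generalizing F with
  | zero => simp [h0]
  | succ n ih =>
    rw [iteratedDeriv_succ']
    refine ih (hF.timeDeriv hV) ?_ ?_
    · ext w
      have := heq t₀ ht₀ w
      rw [h0, hT.map_zero] at this
      simpa [WeylStar.timeDeriv] using this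
    · intro t ht w
      have e : (fun s => WeylStar.timeDeriv F s w) =ᶠ[𝓝 t] fun s => c * T (F s) w := by
        filter_upwards [hV.mem_nhds ht] with s hs using heq s hs w
      rw [e.deriv_eq,
        deriv_const_mul _ ((hT.holOn V F hV hF).hasDerivAt hV ht w).differentiableAt]
      exact congrArg (c * ·) (congrFun (hT.timeDeriv V F hV hF t ht) w)

/-- A holomorphic solution of a linear evolution equation vanishes if it vanishes at one time. -/
theorem IsHolOperator.eventually_eq_zero {T : Symbol → Symbol} (hT : IsHolOperator T) {V : Set ℂ}
    (hV : IsOpen V) {t₀ c : ℂ} (ht₀ : t₀ ∈ V) {F : ℂ → Symbol} (hF : HolOn V F)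
    (h0 : F t₀ = 0) (heq : ∀ t ∈ V, ∀ u, deriv (fun s => F s u) t = c * T (F t) u) :
    ∀ᶠ t in 𝓝 t₀, F t = 0 := by
  obtain ⟨r, hr, hrV⟩ := Metric.isOpen_iff.1 hV t₀ ht₀
  filter_upwards [Metric.ball_mem_nhds t₀ hr] with t ht
  ext u
  have h := Complex.taylorSeries_eq_on_ball' ht ((hF.differentiableOn_time hV u).mono hrV)
  rw [← h]
  simp [hT.iteratedDeriv_eq_zero hV ht₀ _ hF h0 heq u]

theorem IsLocalSolution.eventuallyEq {F G : ℂ → Symbol} {t₀ : ℂ}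
    (hF : IsLocalSolution ħ K g t₀ F) (hG : IsLocalSolution ħ K g t₀ G) (h : F t₀ = G t₀) :
    ∀ᶠ t in 𝓝 t₀, F t = G t := by
  obtain ⟨V, hV, htV, hFV, hFe⟩ := hF
  obtain ⟨W, hW, htW, hGW, hGe⟩ := hG
  have hF' : HolOn (V ∩ W) F := HolOn.mono hFV inter_subset_left
  have hG' : HolOn (V ∩ W) G := HolOn.mono hGW inter_subset_right
  have hVW := hV.inter hW
  have hT := isHolOperator_quadStar ħ K g
  have := hT.eventually_eq_zero hVW (c := 1 / (Complex.I * (ħ : ℂ))) ⟨htV, htW⟩ (hF'.sub hG')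
    (sub_eq_zero.2 h) (by
      intro t ht u
      have h1 := (hF'.hasDerivAt hVW ht u).differentiableAt
      have h2 := (hG'.hasDerivAt hVW ht u).differentiableAt
      rw [hT.map_sub _ _ (hF'.differentiable hVW ht) (hG'.differentiable hVW ht)]
      simp only [Pi.sub_apply]
      rw [deriv_fun_sub h1 h2, hFe t ht.1 u, hGe t ht.2 u, mul_sub])
  filter_upwards [this] with t ht using sub_eq_zero.1 ht

/-! ### The action of the quadratic element on Gaussians -/

/-- An affine function of `𝒖` times a Gaussian. -/
def affineGaussian (c A B C a b e : ℂ) : Symbol := fun u =>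
  (a * u 0 + b * u 1 + e) * Complex.exp (c * (A * u 0 ^ 2 + 2 * B * u 0 * u 1 + C * u 1 ^ 2))

theorem hasFDerivAt_affineGaussian (c A B C a b e : ℂ) (u : Fin 2 → ℂ) :
    HasFDerivAt (affineGaussian c A B C a b e)
      (((a + (a * u 0 + b * u 1 + e) * (c * (2 * A * u 0 + 2 * B * u 1))) *
          Complex.exp (c * (A * u 0 ^ 2 + 2 * B * u 0 * u 1 + C * u 1 ^ 2))) •
          ContinuousLinearMap.proj (R := ℂ) (φ := fun _ : Fin 2 => ℂ) 0 +
        ((b + (a * u 0 + b * u 1 + e) * (c * (2 * B * u 0 + 2 * C * u 1))) *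
          Complex.exp (c * (A * u 0 ^ 2 + 2 * B * u 0 * u 1 + C * u 1 ^ 2))) •
          ContinuousLinearMap.proj (R := ℂ) (φ := fun _ : Fin 2 => ℂ) 1) u := by
  have h0 : HasFDerivAt (fun u : Fin 2 → ℂ => u 0) _ u :=
    (ContinuousLinearMap.proj (R := ℂ) (φ := fun _ : Fin 2 => ℂ) 0).hasFDerivAt
  have h1 : HasFDerivAt (fun u : Fin 2 → ℂ => u 1) _ u :=
    (ContinuousLinearMap.proj (R := ℂ) (φ := fun _ : Fin 2 => ℂ) 1).hasFDerivAt
  have hl := ((h0.const_mul a).add (h1.const_mul b)).add_const e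
  have hq := ((((h0.pow 2).const_mul A).add ((h0.const_mul (2 * B)).mul h1)).add
    ((h1.pow 2).const_mul C)).const_mul c
  refine (hl.mul hq.cexp).congr_fderiv ?_
  ext v
  simp
  ring

/-- The affine prefactor is what the twofold action of a linear form requires: the first application
to a Gaussian creates a linear prefactor, and the second differentiates it. -/
theorem genStar_affineGaussian (ħ : ℝ) (hħ : ħ ≠ 0) (K : Matrix (Fin 2) (Fin 2) ℂ)
    (A B C a b e : ℂ) (i : Fin 2) (u : Fin 2 → ℂ) :
    genStar ħ K i (affineGaussian (1 / (Complex.I * ħ)) A B C a b e) u =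
      ((a * u 0 + b * u 1 + e) * (u i + (K + J) i 0 * (A * u 0 + B * u 1) +
          (K + J) i 1 * (B * u 0 + C * u 1)) +
        Complex.I * ħ / 2 * ((K + J) i 0 * a + (K + J) i 1 * b)) *
        Complex.exp (1 / (Complex.I * ħ) * (A * u 0 ^ 2 + 2 * B * u 0 * u 1 + C * u 1 ^ 2)) := by
  have hne : (Complex.I * ħ : ℂ) ≠ 0 := by simp [hħ]
  rw [genStar, Fin.sum_univ_two, (hasFDerivAt_affineGaussian ..).fderiv]
  simp only [affineGaussian, _root_.add_apply, _root_.smul_apply,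
    ContinuousLinearMap.proj_apply, Pi.single_apply, smul_eq_mul]
  generalize Complex.exp _ = X
  generalize (Complex.I * ħ : ℂ) = y at hne ⊢
  simp
  field_simp
  ring

theorem linStar_gaussian (ħ : ℝ) (hħ : ħ ≠ 0) (K g : Matrix (Fin 2) (Fin 2) ℂ)
    (A B C r : ℂ) (k : Fin 2) :
    linStar ħ K g k (affineGaussian (1 / (Complex.I * ħ)) A B C 0 0 r) =
      affineGaussian (1 / (Complex.I * ħ)) A B C
        (r * (g 0 k * (1 + (K + J) 0 0 * A + (K + J) 0 1 * B) +
          g 1 k * ((K + J) 1 0 * A + (K + J) 1 1 * B)))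
        (r * (g 0 k * ((K + J) 0 0 * B + (K + J) 0 1 * C) +
          g 1 k * (1 + (K + J) 1 0 * B + (K + J) 1 1 * C))) 0 := by
  ext u
  simp only [linStar, Fin.sum_univ_two, genStar_affineGaussian ħ hħ]
  simp only [affineGaussian]
  ring

/-- Here m and n are the rows of 1 + (K + J)Q, with Q the matrix of the exponent: the generators act
on the Gaussian as multiplication by the linear forms m · 𝒖 and n · 𝒖. The pᵢ are the entries of g
ᵗg, and the term with iħ/2 comes from differentiating these forms. -/
theorem quadStar_gaussian (ħ : ℝ) (hħ : ħ ≠ 0) (K g : Matrix (Fin 2) (Fin 2) ℂ)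
    (A B C r p₁ p₂ p₃ : ℂ) (u : Fin 2 → ℂ) (hp₁ : p₁ = g 0 0 ^ 2 + g 0 1 ^ 2)
    (hp₂ : p₂ = g 0 0 * g 1 0 + g 0 1 * g 1 1) (hp₃ : p₃ = g 1 0 ^ 2 + g 1 1 ^ 2)
    (k₁ k₂ k₃ : ℂ) (hK : K = !![k₁, k₂; k₂, k₃]) (m₁ m₂ n₁ n₂ : ℂ)
    (hm₁ : m₁ = 1 + k₁ * A + (k₂ - 1) * B) (hm₂ : m₂ = k₁ * B + (k₂ - 1) * C)
    (hn₁ : n₁ = (k₂ + 1) * A + k₃ * B) (hn₂ : n₂ = 1 + (k₂ + 1) * B + k₃ * C) :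
    quadStar ħ K g (affineGaussian (1 / (Complex.I * ħ)) A B C 0 0 r) u =
      (p₁ * (m₁ * u 0 + m₂ * u 1) ^ 2 +
        2 * p₂ * (m₁ * u 0 + m₂ * u 1) * (n₁ * u 0 + n₂ * u 1) +
        p₃ * (n₁ * u 0 + n₂ * u 1) ^ 2 +
        Complex.I * ħ / 2 * (p₁ * (k₁ * m₁ + (k₂ - 1) * m₂) +
          p₂ * (k₁ * n₁ + (k₂ - 1) * n₂ + (k₂ + 1) * m₁ + k₃ * m₂) +
          p₃ * ((k₂ + 1) * n₁ + k₃ * n₂))) *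
      (r * Complex.exp (1 / (Complex.I * ħ) *
        (A * u 0 ^ 2 + 2 * B * u 0 * u 1 + C * u 1 ^ 2))) := by
  subst hK hp₁ hp₂ hp₃ hm₁ hm₂ hn₁ hn₂
  simp only [quadStar, Fin.sum_univ_two, linStar_gaussian ħ hħ]
  simp only [linStar, Fin.sum_univ_two, genStar_affineGaussian ħ hħ]
  simp [J]
  ring

/-- For det P = 1, the exponent matrix is Q = sP(c - sKP)⁻¹, with D = det(c - sKP). Hence 1 + (K +
J)Q = (c + sJP)(c - sKP)⁻¹, and the right-hand sides are the entries of (c + sJP) adj(c - sKP) / D.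
-/
theorem gaussian_linear_factor (p₁ p₂ p₃ k₁ k₂ k₃ c s D : ℂ) (hp : p₁ * p₃ - p₂ ^ 2 = 1)
    (hD : D = c ^ 2 - s * c * (k₁ * p₁ + 2 * k₂ * p₂ + k₃ * p₃) + s ^ 2 * (k₁ * k₃ - k₂ ^ 2))
    (hD0 : D ≠ 0) (A B C m₁ m₂ n₁ n₂ : ℂ) (hA : A = (s * c * p₁ - s ^ 2 * k₃) / D)
    (hB : B = (s * c * p₂ + s ^ 2 * k₂) / D) (hC : C = (s * c * p₃ - s ^ 2 * k₁) / D)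
    (hm₁ : m₁ = 1 + k₁ * A + (k₂ - 1) * B) (hm₂ : m₂ = k₁ * B + (k₂ - 1) * C)
    (hn₁ : n₁ = (k₂ + 1) * A + k₃ * B) (hn₂ : n₂ = 1 + (k₂ + 1) * B + k₃ * C) :
    m₁ = ((c - s * p₂) * (c - s * (k₂ * p₂ + k₃ * p₃)) - s ^ 2 * p₃ * (k₂ * p₁ + k₃ * p₂)) / D ∧
    m₂ = ((c - s * p₂) * (s * (k₁ * p₂ + k₂ * p₃)) - s * p₃ * (c - s * (k₁ * p₁ + k₂ * p₂))) / D ∧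
    n₁ = (s * p₁ * (c - s * (k₂ * p₂ + k₃ * p₃)) + (c + s * p₂) * (s * (k₂ * p₁ + k₃ * p₂))) / D ∧
    n₂ = (s ^ 2 * p₁ * (k₁ * p₂ + k₂ * p₃) + (c + s * p₂) * (c - s * (k₁ * p₁ + k₂ * p₂))) / D := by
  have hA' : A * D = s * c * p₁ - s ^ 2 * k₃ := by rw [hA, div_mul_cancel₀ _ hD0]
  have hB' : B * D = s * c * p₂ + s ^ 2 * k₂ := by rw [hB, div_mul_cancel₀ _ hD0]
  have hC' : C * D = s * c * p₃ - s ^ 2 * k₁ := by rw [hC, div_mul_cancel₀ _ hD0]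
  refine ⟨?_, ?_, ?_, ?_⟩ <;> rw [eq_div_iff hD0]
  · rw [hm₁]
    linear_combination hD + k₁ * hA' + (k₂ - 1) * hB' + s ^ 2 * k₂ * hp
  · rw [hm₂]
    linear_combination k₁ * hB' + (k₂ - 1) * hC' - s ^ 2 * k₁ * hp
  · rw [hn₁]
    linear_combination (k₂ + 1) * hA' + k₃ * hB' + s ^ 2 * k₃ * hp
  · rw [hn₂]
    linear_combination hD + (k₂ + 1) * hB' + k₃ * hC' - s ^ 2 * k₂ * hp

/-- The algebraic identities behind the evolution of the amplitude and of the exponent of the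
Gaussian. -/
theorem gaussian_amplitude_identity (p₁ p₂ p₃ k₁ k₂ k₃ c s D : ℂ) (hp : p₁ * p₃ - p₂ ^ 2 = 1)
    (hD : D = c ^ 2 - s * c * (k₁ * p₁ + 2 * k₂ * p₂ + k₃ * p₃) + s ^ 2 * (k₁ * k₃ - k₂ ^ 2))
    (hD0 : D ≠ 0) (A B C m₁ m₂ n₁ n₂ : ℂ) (hA : A = (s * c * p₁ - s ^ 2 * k₃) / D)
    (hB : B = (s * c * p₂ + s ^ 2 * k₂) / D) (hC : C = (s * c * p₃ - s ^ 2 * k₁) / D)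
    (hm₁ : m₁ = 1 + k₁ * A + (k₂ - 1) * B) (hm₂ : m₂ = k₁ * B + (k₂ - 1) * C)
    (hn₁ : n₁ = (k₂ + 1) * A + k₃ * B) (hn₂ : n₂ = 1 + (k₂ + 1) * B + k₃ * C) :
    p₁ * (k₁ * m₁ + (k₂ - 1) * m₂) +
          p₂ * (k₁ * n₁ + (k₂ - 1) * n₂ + (k₂ + 1) * m₁ + k₃ * m₂) +
          p₃ * ((k₂ + 1) * n₁ + k₃ * n₂) =
      (2 * s * c + (c ^ 2 - s ^ 2) * (k₁ * p₁ + 2 * k₂ * p₂ + k₃ * p₃) -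
        2 * s * c * (k₁ * k₃ - k₂ ^ 2)) / D := by
  obtain ⟨h1, h2, h3, h4⟩ := gaussian_linear_factor p₁ p₂ p₃ k₁ k₂ k₃ c s D hp hD hD0 A B C m₁ m₂
    n₁ n₂ hA hB hC hm₁ hm₂ hn₁ hn₂
  rw [h1, h2, h3, h4]
  field_simp
  linear_combination (2 * s * c - 2 * s * c * (k₁ * k₃ - k₂ ^ 2) -
    s ^ 2 * (k₁ * p₁ + 2 * k₂ * p₂ + k₃ * p₃)) * hp

/-- The form P is evaluated at (c + sJP)v / D, where v = adj(c - sKP) applied to (x, y). The map c +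
sJP multiplies the form P by c² + s² det P = 1 (`e3`), so only the value of P at v remains (`e4`).
The right-hand side is the time derivative of `expo / disc`. -/
theorem gaussian_exponent_identity (p₁ p₂ p₃ k₁ k₂ k₃ c s D : ℂ) (hp : p₁ * p₃ - p₂ ^ 2 = 1)
    (hcs : s ^ 2 + c ^ 2 = 1)
    (hD : D = c ^ 2 - s * c * (k₁ * p₁ + 2 * k₂ * p₂ + k₃ * p₃) + s ^ 2 * (k₁ * k₃ - k₂ ^ 2))
    (hD0 : D ≠ 0) (A B C m₁ m₂ n₁ n₂ : ℂ) (hA : A = (s * c * p₁ - s ^ 2 * k₃) / D)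
    (hB : B = (s * c * p₂ + s ^ 2 * k₂) / D) (hC : C = (s * c * p₃ - s ^ 2 * k₁) / D)
    (hm₁ : m₁ = 1 + k₁ * A + (k₂ - 1) * B) (hm₂ : m₂ = k₁ * B + (k₂ - 1) * C)
    (hn₁ : n₁ = (k₂ + 1) * A + k₃ * B) (hn₂ : n₂ = 1 + (k₂ + 1) * B + k₃ * C) (x y : ℂ) :
    p₁ * (m₁ * x + m₂ * y) ^ 2 + 2 * p₂ * (m₁ * x + m₂ * y) * (n₁ * x + n₂ * y) +
        p₃ * (n₁ * x + n₂ * y) ^ 2 =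
      ((c ^ 2 - (k₁ * k₃ - k₂ ^ 2) * s ^ 2) * (p₁ * x ^ 2 + 2 * p₂ * x * y + p₃ * y ^ 2) +
        ((k₁ * p₁ + 2 * k₂ * p₂ + k₃ * p₃) * s ^ 2 - 2 * s * c) *
          (k₃ * x ^ 2 - 2 * k₂ * x * y + k₁ * y ^ 2)) / D ^ 2 := by
  obtain ⟨h1, h2, h3, h4⟩ := gaussian_linear_factor p₁ p₂ p₃ k₁ k₂ k₃ c s D hp hD hD0 A B C m₁ m₂
    n₁ n₂ hA hB hC hm₁ hm₂ hn₁ hn₂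
  set v₁ : ℂ := (c - s * (k₂ * p₂ + k₃ * p₃)) * x + s * (k₁ * p₂ + k₂ * p₃) * y with hv₁
  set v₂ : ℂ := s * (k₂ * p₁ + k₃ * p₂) * x + (c - s * (k₁ * p₁ + k₂ * p₂)) * y with hv₂
  have e1 : m₁ * x + m₂ * y = ((c - s * p₂) * v₁ - s * p₃ * v₂) / D := by
    rw [h1, h2, hv₁, hv₂]
    ring
  have e2 : n₁ * x + n₂ * y = (s * p₁ * v₁ + (c + s * p₂) * v₂) / D := by
    rw [h3, h4, hv₁, hv₂]
    ring
  have e3 : p₁ * ((c - s * p₂) * v₁ - s * p₃ * v₂) ^ 2 + 2 * p₂ * ((c - s * p₂) * v₁ -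
      s * p₃ * v₂) * (s * p₁ * v₁ + (c + s * p₂) * v₂) + p₃ * (s * p₁ * v₁ + (c + s * p₂) * v₂) ^ 2 =
      (c ^ 2 + s ^ 2 * (p₁ * p₃ - p₂ ^ 2)) * (p₁ * v₁ ^ 2 + 2 * p₂ * v₁ * v₂ + p₃ * v₂ ^ 2) := by
    ring
  have e4 : p₁ * v₁ ^ 2 + 2 * p₂ * v₁ * v₂ + p₃ * v₂ ^ 2 =
      c ^ 2 * (p₁ * x ^ 2 + 2 * p₂ * x * y + p₃ * y ^ 2) -
      2 * s * c * (p₁ * p₃ - p₂ ^ 2) * (k₃ * x ^ 2 - 2 * k₂ * x * y + k₁ * y ^ 2) +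
      s ^ 2 * (p₁ * p₃ - p₂ ^ 2) * ((k₁ * p₁ + 2 * k₂ * p₂ + k₃ * p₃) *
        (k₃ * x ^ 2 - 2 * k₂ * x * y + k₁ * y ^ 2) -
        (k₁ * k₃ - k₂ ^ 2) * (p₁ * x ^ 2 + 2 * p₂ * x * y + p₃ * y ^ 2)) := by
    rw [hv₁, hv₂]
    ring
  rw [hp] at e3 e4
  rw [show c ^ 2 + s ^ 2 * 1 = 1 by linear_combination hcs, e4] at e3
  rw [e1, e2, eq_div_iff (pow_ne_zero 2 hD0)]
  generalize (c - s * p₂) * v₁ - s * p₃ * v₂ = a at e3 ⊢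
  generalize s * p₁ * v₁ + (c + s * p₂) * v₂ = b at e3 ⊢
  field_simp
  linear_combination e3

/-! ### The explicit solution of the evolution equation -/

/-- `det (cos t - sin t K P)` for `P` of determinant one. -/
def disc (K P : Matrix (Fin 2) (Fin 2) ℂ) (t : ℂ) : ℂ :=
  Complex.cos t ^ 2 - Complex.sin t * Complex.cos t * (K * P).trace + Complex.sin t ^ 2 * K.det

/-- The quadratic form `sin t · 𝒖 (cos t P - sin t adj K) ᵗ𝒖`. -/
def expo (K P : Matrix (Fin 2) (Fin 2) ℂ) (t : ℂ) (u : Fin 2 → ℂ) : ℂ :=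
  Complex.sin t * Complex.cos t * (P 0 0 * u 0 ^ 2 + (P 0 1 + P 1 0) * u 0 * u 1 + P 1 1 * u 1 ^ 2) -
    Complex.sin t ^ 2 * (K 1 1 * u 0 ^ 2 - (K 0 1 + K 1 0) * u 0 * u 1 + K 0 0 * u 1 ^ 2)

/-- The Gaussian with amplitude `r`, which solves the evolution equation if `r² = 1 / disc`. -/
def gaussian (ħ : ℝ) (K P : Matrix (Fin 2) (Fin 2) ℂ) (r : ℂ → ℂ) (t : ℂ) : Symbol := fun u =>
  r t * Complex.exp (1 / (Complex.I * ħ) * (expo K P t u / disc K P t))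

variable {ħ : ℝ} {K P g : Matrix (Fin 2) (Fin 2) ℂ}

theorem disc_zero : disc K P 0 = 1 := by simp [disc]

theorem differentiable_disc : Differentiable ℂ (disc K P) := by
  unfold disc
  fun_prop

theorem hasDerivAt_disc (t : ℂ) : HasDerivAt (disc K P)
    (-(2 * Complex.sin t * Complex.cos t) -
      (Complex.cos t ^ 2 - Complex.sin t ^ 2) * (K * P).trace +
      2 * Complex.sin t * Complex.cos t * K.det) t := by
  have hs := Complex.hasDerivAt_sin t
  have hc := Complex.hasDerivAt_cos t
  refine (((hc.pow 2).sub ((hs.mul hc).mul_const (K * P).trace)).add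
    ((hs.pow 2).mul_const K.det)).congr_deriv ?_
  simp
  ring

theorem hasDerivAt_expo (t : ℂ) (u : Fin 2 → ℂ) : HasDerivAt (fun t => expo K P t u)
    ((Complex.cos t ^ 2 - Complex.sin t ^ 2) *
        (P 0 0 * u 0 ^ 2 + (P 0 1 + P 1 0) * u 0 * u 1 + P 1 1 * u 1 ^ 2) -
      2 * Complex.sin t * Complex.cos t *
        (K 1 1 * u 0 ^ 2 - (K 0 1 + K 1 0) * u 0 * u 1 + K 0 0 * u 1 ^ 2)) t := by
  have hs := Complex.hasDerivAt_sin t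
  have hc := Complex.hasDerivAt_cos t
  refine (((hs.mul hc).mul_const _).sub ((hs.pow 2).mul_const _)).congr_deriv ?_
  simp only [Nat.cast_ofNat, Nat.add_one_sub_one, pow_one]
  ring

theorem holOn_gaussian {V : Set ℂ} {r : ℂ → ℂ} (hr : DifferentiableOn ℂ r V)
    (hD : ∀ t ∈ V, disc K P t ≠ 0) : HolOn V (gaussian ħ K P r) := by
  have h1 : DifferentiableOn ℂ (fun p : ℂ × (Fin 2 → ℂ) => r p.1) (V ×ˢ univ) :=
    hr.comp differentiableOn_fst fun p hp => hp.1
  have h2 : Differentiable ℂ (fun p : ℂ × (Fin 2 → ℂ) => disc K P p.1) :=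
    differentiable_disc.comp differentiable_fst
  have h3 : Differentiable ℂ (fun p : ℂ × (Fin 2 → ℂ) => expo K P p.1 p.2) := by
    unfold expo
    fun_prop
  have h5 : ∀ p ∈ V ×ˢ (univ : Set (Fin 2 → ℂ)), disc K P p.1 ≠ 0 := fun p hp => hD p.1 hp.1
  have h4 : DifferentiableOn ℂ
      (fun p : ℂ × (Fin 2 → ℂ) => expo K P p.1 p.2 / disc K P p.1) (V ×ˢ univ) := by
    simp only [div_eq_mul_inv]
    exact h3.differentiableOn.fun_mul (h2.differentiableOn.fun_inv h5)
  exact DifferentiableOn.mul h1 (h4.const_mul _).cexp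

/-- The Gaussians solve the evolution equation. -/
theorem isLocalSolution_gaussian (hħ : ħ ≠ 0) (hK : K.IsSymm) (hg : g.det = 1) {V : Set ℂ}
    (hV : IsOpen V) {r : ℂ → ℂ} (hr : DifferentiableOn ℂ r V)
    (hD : ∀ t ∈ V, r t ^ 2 * disc K (g * gᵀ) t = 1) {t₀ : ℂ} (ht₀ : t₀ ∈ V) :
    IsLocalSolution ħ K g t₀ (gaussian ħ K (g * gᵀ) r) := by
  have hD0 : ∀ t ∈ V, disc K (g * gᵀ) t ≠ 0 := fun t ht h => by
    have := hD t ht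
    rw [h] at this
    simp at this
  refine ⟨V, hV, ht₀, holOn_gaussian hr hD0, fun t ht u => ?_⟩
  obtain ⟨k₁, k₂, k₃, rfl⟩ : ∃ k₁ k₂ k₃, K = !![k₁, k₂; k₂, k₃] := by
    refine ⟨K 0 0, K 0 1, K 1 1, ?_⟩
    conv_lhs => rw [K.eta_fin_two]
    rw [hK.apply 0 1]
  set K : Matrix (Fin 2) (Fin 2) ℂ := !![k₁, k₂; k₂, k₃] with hKdef
  set p₁ := g 0 0 ^ 2 + g 0 1 ^ 2 with hp₁
  set p₂ := g 0 0 * g 1 0 + g 0 1 * g 1 1 with hp₂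
  set p₃ := g 1 0 ^ 2 + g 1 1 ^ 2 with hp₃
  set c := Complex.cos t with hc
  set s := Complex.sin t with hs
  set D := disc K (g * gᵀ) t with hDt
  have hP : g * gᵀ = !![p₁, p₂; p₂, p₃] := by
    ext i j
    fin_cases i <;> fin_cases j <;> simp [Matrix.mul_apply, Fin.sum_univ_two, hp₁, hp₂, hp₃] <;> ring
  have hp : p₁ * p₃ - p₂ ^ 2 = 1 := by
    rw [Matrix.det_fin_two] at hg
    rw [hp₁, hp₂, hp₃]
    linear_combination (g 0 0 * g 1 1 - g 0 1 * g 1 0 + 1) * hg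
  have htr : (K * (g * gᵀ)).trace = k₁ * p₁ + 2 * k₂ * p₂ + k₃ * p₃ := by
    rw [hP]
    simp [hKdef, Matrix.trace_fin_two]
    ring
  have hdet : K.det = k₁ * k₃ - k₂ ^ 2 := by
    rw [hKdef, Matrix.det_fin_two_of]
    ring
  have hDe : D = c ^ 2 - s * c * (k₁ * p₁ + 2 * k₂ * p₂ + k₃ * p₃) + s ^ 2 * (k₁ * k₃ - k₂ ^ 2) := by
    rw [hDt, disc, htr, hdet]
  have hDne : D ≠ 0 := hD0 t ht
  have hcs : s ^ 2 + c ^ 2 = 1 := Complex.sin_sq_add_cos_sq t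
  have hne : (Complex.I * ħ : ℂ) ≠ 0 := by simp [hħ]
  -- the spatial side
  have hgauss : gaussian ħ K (g * gᵀ) r t = affineGaussian (1 / (Complex.I * ħ))
      ((s * c * p₁ - s ^ 2 * k₃) / D) ((s * c * p₂ + s ^ 2 * k₂) / D)
      ((s * c * p₃ - s ^ 2 * k₁) / D) 0 0 (r t) := by
    ext u
    have he : expo K (g * gᵀ) t u = (s * c * p₁ - s ^ 2 * k₃) * u 0 ^ 2 +
        2 * (s * c * p₂ + s ^ 2 * k₂) * u 0 * u 1 + (s * c * p₃ - s ^ 2 * k₁) * u 1 ^ 2 := by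
      simp only [expo, hP, hKdef, ← hs, ← hc]
      simp
      ring
    simp only [gaussian, affineGaussian]
    rw [he, ← hDt, zero_mul, zero_mul, zero_add, zero_add]
    congr 3
    field_simp
  have hq := quadStar_gaussian ħ hħ K g ((s * c * p₁ - s ^ 2 * k₃) / D)
    ((s * c * p₂ + s ^ 2 * k₂) / D) ((s * c * p₃ - s ^ 2 * k₁) / D) (r t) p₁ p₂ p₃ u hp₁ hp₂ hp₃
    k₁ k₂ k₃ hKdef _ _ _ _ rfl rfl rfl rfl
  rw [gaussian_amplitude_identity p₁ p₂ p₃ k₁ k₂ k₃ c s D hp hDe hDne _ _ _ _ _ _ _ rfl rfl rfl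
      rfl rfl rfl rfl, gaussian_exponent_identity p₁ p₂ p₃ k₁ k₂ k₃ c s D hp hcs hDe hDne
      _ _ _ _ _ _ _ rfl rfl rfl rfl rfl rfl rfl, ← hgauss] at hq
  set E := expo K (g * gᵀ) t u with hE
  set X := Complex.exp (1 / (Complex.I * ħ) * (E / D)) with hX
  have hX' := congrFun hgauss u
  simp only [gaussian, affineGaussian, zero_mul, zero_add, ← hDt, ← hE, ← hX] at hX'
  rw [hq, ← hX']
  have hP0 : (g * gᵀ) 0 0 = p₁ ∧ (g * gᵀ) 0 1 = p₂ ∧ (g * gᵀ) 1 0 = p₂ ∧ (g * gᵀ) 1 1 = p₃ := by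
    simp [hP]
  have hE' : E = s * c * (p₁ * u 0 ^ 2 + (p₂ + p₂) * u 0 * u 1 + p₃ * u 1 ^ 2) -
      s ^ 2 * (k₃ * u 0 ^ 2 - (k₂ + k₂) * u 0 * u 1 + k₁ * u 1 ^ 2) := by
    simp [hE, expo, hP0, ← hs, ← hc, hKdef]
  -- the time derivative
  obtain ⟨D', hD'⟩ : ∃ D', D' = -(2 * s * c) - (c ^ 2 - s ^ 2) *
      (k₁ * p₁ + 2 * k₂ * p₂ + k₃ * p₃) + 2 * s * c * (k₁ * k₃ - k₂ ^ 2) := ⟨_, rfl⟩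
  have hDd : HasDerivAt (disc K (g * gᵀ)) D' t := by
    rw [hD', ← htr, ← hdet]
    exact hasDerivAt_disc t
  obtain ⟨E', hEd, hE''⟩ : ∃ E', HasDerivAt (fun t => expo K (g * gᵀ) t u) E' t ∧ E' =
      (c ^ 2 - s ^ 2) * (p₁ * u 0 ^ 2 + (p₂ + p₂) * u 0 * u 1 + p₃ * u 1 ^ 2) -
        2 * s * c * (k₃ * u 0 ^ 2 - (k₂ + k₂) * u 0 * u 1 + k₁ * u 1 ^ 2) := by
    refine ⟨_, hasDerivAt_expo t u, ?_⟩
    simp [hP0, ← hs, ← hc, hKdef]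
  have hrd := (hr.differentiableAt (hV.mem_nhds ht)).hasDerivAt
  -- Differentiating r² · `disc` = 1 determines r' without choosing a branch of the root.
  have hrel := ((hrd.fun_pow 2).fun_mul hDd).unique
    ((hasDerivAt_const t (1 : ℂ)).congr_of_eventuallyEq (by
      filter_upwards [hV.mem_nhds ht] with w hw using hD w hw))
  have hr0 : r t ≠ 0 := fun h => by
    have := hD t ht
    rw [h] at this
    simp at this
  have hr' : deriv r t = -(r t * D') / (2 * D) := by
    rw [eq_div_iff (by simp [hDne])]
    simp only [← hDt, Nat.cast_ofNat, Nat.add_one_sub_one, pow_one] at hrel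
    refine mul_left_cancel₀ hr0 ?_
    linear_combination hrel
  have hFd : HasDerivAt (fun s => gaussian ħ K (g * gᵀ) r s u) (deriv r t * X +
      r t * (X * (1 / (Complex.I * ħ) * ((E' * D - E * D') / D ^ 2)))) t :=
    hrd.fun_mul ((hEd.fun_div hDd hDne).const_mul (1 / (Complex.I * (ħ : ℂ)))).cexp
  have hkey : E' * D - E * D' = (c ^ 2 - (k₁ * k₃ - k₂ ^ 2) * s ^ 2) *
        (p₁ * u 0 ^ 2 + 2 * p₂ * u 0 * u 1 + p₃ * u 1 ^ 2) +
      ((k₁ * p₁ + 2 * k₂ * p₂ + k₃ * p₃) * s ^ 2 - 2 * s * c) *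
        (k₃ * u 0 ^ 2 - 2 * k₂ * u 0 * u 1 + k₁ * u 1 ^ 2) := by
    rw [hE'', hE', hDe, hD']
    -- The numerator E'D - ED' is the right-hand side multiplied by s² + c².
    linear_combination ((c ^ 2 - (k₁ * k₃ - k₂ ^ 2) * s ^ 2) *
        (p₁ * u 0 ^ 2 + 2 * p₂ * u 0 * u 1 + p₃ * u 1 ^ 2) +
      ((k₁ * p₁ + 2 * k₂ * p₂ + k₃ * p₃) * s ^ 2 - 2 * s * c) *
        (k₃ * u 0 ^ 2 - 2 * k₂ * u 0 * u 1 + k₁ * u 1 ^ 2)) * hcs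
  rw [hFd.deriv, ← hkey, hr', show 2 * s * c + (c ^ 2 - s ^ 2) *
    (k₁ * p₁ + 2 * k₂ * p₂ + k₃ * p₃) - 2 * s * c * (k₁ * k₃ - k₂ ^ 2) = -D' by rw [hD']; ring]
  generalize (Complex.I * ħ : ℂ) = y at hne ⊢
  field_simp
  ring

/-! ### Analytic continuation along paths -/

/-- A locally constant truth value on a connected set is constant. This propagates properties of
germs along a path, both equality of two continuations and the Gaussian form. -/
theorem IsPreconnected.forall_of_eventually_iff {I : Set ℝ} (hI : IsPreconnected I) {X : ℝ → Prop}
    {a : ℝ} (ha : a ∈ I) (h0 : X a) (h : ∀ s ∈ I, ∀ᶠ s' in 𝓝[I] s, (X s' ↔ X s)) :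
    ∀ s ∈ I, X s := by
  have : PreconnectedSpace I := isPreconnected_iff_preconnectedSpace.1 hI
  have hc : IsLocallyConstant (fun s : I => X s) := by
    rw [IsLocallyConstant.iff_eventually_eq]
    intro s
    have := h s s.2
    rw [← map_nhds_subtype_val] at this
    exact (eventually_map.1 this).mono fun _ hs => propext hs
  intro s hs
  have := hc.apply_eq_of_preconnectedSpace ⟨s, hs⟩ ⟨a, ha⟩
  simp only [eq_iff_iff] at this
  exact this.2 h0

variable {ħ : ℝ} {K P g : Matrix (Fin 2) (Fin 2) ℂ}

section Germs

theorem HolOn.eq_of_eventually {F G : ℂ → Symbol} {V : Set ℂ} (hV : IsOpen V)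
    (hVc : IsPreconnected V) (hF : HolOn V F) (hG : HolOn V G) {t₁ : ℂ} (ht₁ : t₁ ∈ V)
    (h : ∀ᶠ t in 𝓝 t₁, F t = G t) : ∀ t ∈ V, F t = G t := by
  intro t ht
  ext u
  exact ((hF.differentiableOn_time hV u).analyticOnNhd hV).eqOn_of_preconnected_of_eventuallyEq
    ((hG.differentiableOn_time hV u).analyticOnNhd hV) hVc ht₁
    (h.mono fun s hs => congrFun hs u) ht

theorem IsLocalSolution.exists_holOn_ball {F : ℂ → Symbol} {t₀ : ℂ}
    (hF : IsLocalSolution ħ K g t₀ F) : ∃ r > 0, HolOn (Metric.ball t₀ r) F := by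
  obtain ⟨V, hV, ht, hh, -⟩ := hF
  obtain ⟨r, hr, hrV⟩ := Metric.isOpen_iff.1 hV t₀ ht
  exact ⟨r, hr, HolOn.mono hh hrV⟩

/-- At the time `t`, the function `F` is a Gaussian as in `gaussian`, of amplitude `F t 0`. -/
def IsGaussianAt (ħ : ℝ) (K P : Matrix (Fin 2) (Fin 2) ℂ) (F : ℂ → Symbol) (t : ℂ) : Prop :=
  F t 0 ^ 2 * disc K P t = 1 ∧ F t = gaussian ħ K P (fun s => F s 0) t

theorem IsGaussianAt.disc_ne_zero {F : ℂ → Symbol} {t : ℂ} (h : IsGaussianAt ħ K P F t) :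
    disc K P t ≠ 0 := fun h0 => by
  have := h.1
  rw [h0] at this
  simp at this

theorem IsGaussianAt.congr {F G : ℂ → Symbol} {t : ℂ} (h : IsGaussianAt ħ K P F t)
    (e : F t = G t) : IsGaussianAt ħ K P G t := by
  refine ⟨by rw [← e]; exact h.1, ?_⟩
  rw [← e]
  refine h.2.trans ?_
  ext u
  simp only [gaussian, e]

/-- At 𝒖 = 0 the exponential factor is 1, so the amplitude can be read off from the function itself
and no branch has to be named. -/
theorem expo_zero_right (t : ℂ) : expo K P t 0 = 0 := by simp [expo]

theorem isGaussianAt_gaussian {r : ℂ → ℂ} {t : ℂ} (h : r t ^ 2 * disc K P t = 1) :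
    IsGaussianAt ħ K P (gaussian ħ K P r) t := by
  constructor
  · simpa [gaussian, expo_zero_right] using h
  · ext u
    simp [gaussian, expo_zero_right]

/-- The identity theorem extends the relation amplitude² · `disc` = 1 to all of V, which excludes
zeros of `disc` there. Only then is the Gaussian known to be holomorphic on V, and a second use of
the identity theorem extends the equality with F. -/
theorem HolOn.isGaussianAt_of_eventually {F : ℂ → Symbol} {V : Set ℂ} (hV : IsOpen V)
    (hVc : IsPreconnected V) (hF : HolOn V F) {t₁ : ℂ} (ht₁ : t₁ ∈ V)
    (h : ∀ᶠ t in 𝓝 t₁, IsGaussianAt ħ K P F t) : ∀ t ∈ V, IsGaussianAt ħ K P F t := by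
  have hd := hF.differentiableOn_time hV 0
  have h1 : ∀ t ∈ V, F t 0 ^ 2 * disc K P t = 1 := fun t ht =>
    (((hd.pow 2).mul differentiable_disc.differentiableOn).analyticOnNhd
      hV).eqOn_of_preconnected_of_eventuallyEq
      (analyticOnNhd_const (v := (1 : ℂ))) hVc ht₁ (h.mono fun s hs => hs.1) ht
  have hD0 : ∀ t ∈ V, disc K P t ≠ 0 := fun t ht h0 => by
    have := h1 t ht
    rw [h0] at this
    simp at this
  have h2 := HolOn.eq_of_eventually hV hVc hF (holOn_gaussian (ħ := ħ) hd hD0) ht₁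
    (h.mono fun s hs => hs.2)
  exact fun t ht => ⟨h1 t ht, h2 t ht⟩

end Germs

section Roots

/-- A local branch of `disc ^ (-1/2)` near `t₀`, given a logarithm `l` of `disc` at `t₀`. -/
def localRoot (K P : Matrix (Fin 2) (Fin 2) ℂ) (t₀ l t : ℂ) : ℂ :=
  Complex.exp (-(l + Complex.log (disc K P t / disc K P t₀)) / 2)

theorem localRoot_sq {t₀ l t : ℂ} (hl : Complex.exp l = disc K P t₀) (ht : disc K P t ≠ 0) :
    localRoot K P t₀ l t ^ 2 * disc K P t = 1 := by
  have h0 : disc K P t₀ ≠ 0 := hl ▸ Complex.exp_ne_zero l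
  rw [localRoot, ← Complex.exp_nat_mul]
  rw [show ((2 : ℕ) : ℂ) * (-(l + Complex.log (disc K P t / disc K P t₀)) / 2) =
    -(l + Complex.log (disc K P t / disc K P t₀)) by push_cast; ring, Complex.exp_neg,
    Complex.exp_add, Complex.exp_log (div_ne_zero ht h0), hl]
  field_simp

theorem exists_isOpen_localRoot {t₀ : ℂ} (l : ℂ) (h0 : disc K P t₀ ≠ 0) :
    ∃ V, IsOpen V ∧ t₀ ∈ V ∧ DifferentiableOn ℂ (localRoot K P t₀ l) V ∧
      ∀ t ∈ V, disc K P t ≠ 0 := by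
  have hd : Differentiable ℂ (fun t => disc K P t / disc K P t₀) :=
    differentiable_disc.div_const _
  refine ⟨{t | disc K P t / disc K P t₀ ∈ Complex.slitPlane},
    Complex.isOpen_slitPlane.preimage hd.continuous, ?_, ?_, ?_⟩
  · simp [h0]
  · intro t ht
    have h1 := (hd t).clog ht
    exact (((h1.const_add l).neg.div_const 2).cexp).differentiableWithinAt
  · intro t ht h
    simp [h] at ht

end Roots

variable {γ : ℝ → ℂ} {I : Set ℝ} {Φ Ψ : ℝ → ℂ → Symbol}

/-- The germs agree at 0 by uniqueness for the evolution equation. On a ball around γ s on which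
both germs are holomorphic, agreement near one point is equivalent to agreement near any other. -/
theorem IsContinuationAlong.eventually_eq (hI : IsPreconnected I) (h0I : 0 ∈ I)
    (hγ : Continuous γ) (hγ0 : γ 0 = 0) (hΦ : IsContinuationAlong ħ K g γ I Φ)
    (hΨ : IsContinuationAlong ħ K g γ I Ψ) : ∀ s ∈ I, ∀ᶠ t in 𝓝 (γ s), Φ s t = Ψ s t := by
  refine IsPreconnected.forall_of_eventually_iff hI h0I ?_ fun s hs => ?_
  · refine (hΦ.solves 0 h0I).eventuallyEq (hΨ.solves 0 h0I) ?_
    ext u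
    rw [hγ0, hΦ.initial, hΨ.initial]
  · obtain ⟨r₁, hr₁, hF⟩ := (hΦ.solves s hs).exists_holOn_ball
    obtain ⟨r₂, hr₂, hG⟩ := (hΨ.solves s hs).exists_holOn_ball
    set r := min r₁ r₂
    have hr : 0 < r := lt_min hr₁ hr₂
    have hF' := hF.mono (Metric.ball_subset_ball (min_le_left r₁ r₂))
    have hG' := hG.mono (Metric.ball_subset_ball (min_le_right r₁ r₂))
    have hball : ∀ᶠ s' in 𝓝[I] s, γ s' ∈ Metric.ball (γ s) r :=
      (hγ.continuousAt.eventually (Metric.ball_mem_nhds _ hr)).filter_mono nhdsWithin_le_nhds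
    have key : ∀ t₁ ∈ Metric.ball (γ s) r, ∀ t₂ ∈ Metric.ball (γ s) r,
        (∀ᶠ t in 𝓝 t₁, Φ s t = Ψ s t) → ∀ᶠ t in 𝓝 t₂, Φ s t = Ψ s t := by
      intro t₁ h₁ t₂ h₂ h
      filter_upwards [Metric.isOpen_ball.mem_nhds h₂] with t ht
      exact HolOn.eq_of_eventually Metric.isOpen_ball (convex_ball _ _).isPreconnected hF' hG'
        h₁ h t ht
    filter_upwards [hball, hΦ.compatible s hs, hΨ.compatible s hs] with s' hb h1 h2
    have hs' := Metric.mem_ball_self (x := γ s) hr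
    constructor
    · intro h
      refine key _ hb _ hs' ?_
      filter_upwards [h, h1, h2] with t a b c
      rw [← b, ← c, a]
    · intro h
      filter_upwards [key _ hs' _ hb h, h1, h2] with t a b c
      rw [b, c, a]

theorem IsContinuationAlong.isGaussianAt (hħ : ħ ≠ 0) (hK : K.IsSymm) (hg : g.det = 1)
    (hI : IsPreconnected I) (h0I : 0 ∈ I)
    (hγ : Continuous γ) (hγ0 : γ 0 = 0) (hΦ : IsContinuationAlong ħ K g γ I Φ) :
    ∀ s ∈ I, ∀ᶠ t in 𝓝 (γ s), IsGaussianAt ħ K (g * gᵀ) (Φ s) t := by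
  refine IsPreconnected.forall_of_eventually_iff hI h0I ?_ fun s hs => ?_
  · have hd0 : disc K (g * gᵀ) 0 ≠ 0 := by simp [disc_zero]
    obtain ⟨V, hV, h0V, hd, hne⟩ := exists_isOpen_localRoot (t₀ := 0) 0 hd0
    have hsq : ∀ t ∈ V, localRoot K (g * gᵀ) 0 0 t ^ 2 * disc K (g * gᵀ) t = 1 := fun t ht =>
      localRoot_sq (by simp [disc_zero]) (hne t ht)
    have hloc := isLocalSolution_gaussian hħ hK hg hV hd hsq h0V
    have hsol := hΦ.solves 0 h0I
    rw [hγ0] at hsol ⊢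
    have he := hsol.eventuallyEq hloc (by
      ext u
      rw [hΦ.initial]
      simp [gaussian, localRoot, expo, disc_zero])
    filter_upwards [hV.mem_nhds h0V, he] with t ht het
    exact (isGaussianAt_gaussian (ħ := ħ) (hsq t ht)).congr het.symm
  · obtain ⟨r, hr, hF⟩ := (hΦ.solves s hs).exists_holOn_ball
    have hball : ∀ᶠ s' in 𝓝[I] s, γ s' ∈ Metric.ball (γ s) r :=
      (hγ.continuousAt.eventually (Metric.ball_mem_nhds _ hr)).filter_mono nhdsWithin_le_nhds
    have key : ∀ t₁ ∈ Metric.ball (γ s) r, ∀ t₂ ∈ Metric.ball (γ s) r,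
        (∀ᶠ t in 𝓝 t₁, IsGaussianAt ħ K (g * gᵀ) (Φ s) t) →
          ∀ᶠ t in 𝓝 t₂, IsGaussianAt ħ K (g * gᵀ) (Φ s) t := by
      intro t₁ h₁ t₂ h₂ h
      filter_upwards [Metric.isOpen_ball.mem_nhds h₂] with t ht
      exact HolOn.isGaussianAt_of_eventually Metric.isOpen_ball (convex_ball _ _).isPreconnected
        hF h₁ h t ht
    filter_upwards [hball, hΦ.compatible s hs] with s' hb h1
    have hs' := Metric.mem_ball_self (x := γ s) hr
    constructor
    · intro h
      refine key _ hb _ hs' ?_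
      filter_upwards [h, h1] with t a b using a.congr b
    · intro h
      filter_upwards [key _ hs' _ hb h, h1] with t a b using a.congr b.symm

/-- The obstruction to continuation: amplitude² · `disc` = 1 cannot hold at a zero of `disc`. -/
theorem IsContinuationAlong.disc_ne_zero (hħ : ħ ≠ 0) (hK : K.IsSymm) (hg : g.det = 1)
    (hI : IsPreconnected I) (h0I : 0 ∈ I)
    (hγ : Continuous γ) (hγ0 : γ 0 = 0) (hΦ : IsContinuationAlong ħ K g γ I Φ) :
    ∀ s ∈ I, disc K (g * gᵀ) (γ s) ≠ 0 := fun s hs =>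
  (hΦ.isGaussianAt hħ hK hg hI h0I hγ hγ0 s hs).self_of_nhds.disc_ne_zero

/-- A continuous logarithm of `disc` along a path gives a continuation. -/
theorem exists_isContinuationAlong_of_log (hħ : ħ ≠ 0) (hK : K.IsSymm) (hg : g.det = 1)
    (hγ : Continuous γ) (hγ0 : γ 0 = 0) {l : ℝ → ℂ} (hl : ContinuousOn l I)
    (hl0 : l 0 = 0) (hexp : ∀ s ∈ I, Complex.exp (l s) = disc K (g * gᵀ) (γ s)) :
    ∃ Φ, IsContinuationAlong ħ K g γ I Φ := by
  have hne : ∀ s ∈ I, disc K (g * gᵀ) (γ s) ≠ 0 := fun s hs => hexp s hs ▸ Complex.exp_ne_zero _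
  refine ⟨fun s => gaussian ħ K (g * gᵀ) (localRoot K (g * gᵀ) (γ s) (l s)), ?_, ?_, ?_⟩
  · intro u
    simp [gaussian, localRoot, expo, disc_zero, hγ0, hl0]
  · intro s hs
    obtain ⟨V, hV, h0V, hd, hne'⟩ := exists_isOpen_localRoot (l s) (hne s hs)
    exact isLocalSolution_gaussian hħ hK hg hV hd
      (fun t ht => localRoot_sq (hexp s hs) (hne' t ht)) h0V
  · intro s hs
    set D := disc K (g * gᵀ) with hD
    have hDc : Continuous D := differentiable_disc.continuous
    have hs0 : D (γ s) ≠ 0 := hne s hs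
    -- The difference of the logarithms of `disc` used by the germs at s' and at s. It tends to 0
    -- and takes values in 2πiℤ, hence it vanishes nearby and the two branches of the root agree.
    set h : ℝ × ℂ → ℂ := fun p => (l p.1 + Complex.log (D p.2 / D (γ p.1))) -
      (l s + Complex.log (D p.2 / D (γ s))) with hh
    have hlim : Tendsto h (𝓝[I] s ×ˢ 𝓝 (γ s)) (𝓝 0) := by
      have h1 : Tendsto (fun p : ℝ × ℂ => l p.1) (𝓝[I] s ×ˢ 𝓝 (γ s)) (𝓝 (l s)) :=
        (hl s hs).tendsto.comp tendsto_fst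
      have h2 : Tendsto (fun p : ℝ × ℂ => D p.2) (𝓝[I] s ×ˢ 𝓝 (γ s)) (𝓝 (D (γ s))) :=
        (hDc.tendsto _).comp tendsto_snd
      have h3 : Tendsto (fun p : ℝ × ℂ => D (γ p.1)) (𝓝[I] s ×ˢ 𝓝 (γ s)) (𝓝 (D (γ s))) :=
        (((hDc.comp hγ).tendsto s).mono_left nhdsWithin_le_nhds).comp tendsto_fst
      have hone : (1 : ℂ) ∈ Complex.slitPlane := Complex.one_mem_slitPlane
      have h4 := (h2.div h3 hs0)
      have h5 := (h2.div_const (D (γ s)))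
      rw [div_self hs0] at h4 h5
      have := (h1.add (h4.clog hone)).sub ((tendsto_const_nhds (x := l s)).add (h5.clog hone))
      simpa [hh] using this
    have hsmall : ∀ᶠ p in 𝓝[I] s ×ˢ 𝓝 (γ s), ‖h p‖ < 1 ∧ D p.2 ≠ 0 := by
      refine (hlim.norm.eventually (by simpa using gt_mem_nhds (zero_lt_one (α := ℝ)))).and ?_
      exact tendsto_snd.eventually (hDc.continuousAt.eventually_ne hs0)
    obtain ⟨pa, hpa, pb, hpb, hab⟩ := eventually_prod_iff.1 hsmall
    have hγs : Tendsto γ (𝓝[I] s) (𝓝 (γ s)) := (hγ.tendsto s).mono_left nhdsWithin_le_nhds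
    filter_upwards [hpa, hγs.eventually hpb.eventually_nhds, self_mem_nhdsWithin] with s' ha hb hs'
    filter_upwards [hb] with t ht
    obtain ⟨hlt, hDt⟩ := hab ha ht
    have hexp1 : Complex.exp (h (s', t)) = 1 := by
      simp only [hh]
      rw [Complex.exp_sub, Complex.exp_add, Complex.exp_add, Complex.exp_log
        (div_ne_zero hDt (hne s' hs')), Complex.exp_log (div_ne_zero hDt hs0), hexp s hs,
        hexp s' hs']
      have := hne s' hs'
      field_simp
    have hzero : h (s', t) = 0 := by
      obtain ⟨n, hn⟩ := Complex.exp_eq_one_iff.1 hexp1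
      rw [hn] at hlt ⊢
      rcases eq_or_ne n 0 with rfl | hn0
      · simp
      · exfalso
        have h1 : (1 : ℝ) ≤ |(n : ℝ)| := by exact_mod_cast Int.one_le_abs hn0
        rw [norm_mul, norm_mul, norm_mul, Complex.norm_I, Complex.norm_real, Complex.norm_intCast,
          Real.norm_of_nonneg Real.pi_pos.le] at hlt
        norm_num at hlt
        nlinarith [Real.pi_gt_three]
    have heq := sub_eq_zero.1 hzero
    ext u
    simp only [gaussian, localRoot]
    rw [heq]

theorem exists_continuous_log {f : ℝ → ℂ} (hf : Continuous f) (h0 : ∀ x, f x ≠ 0) :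
    ∃ l : ℝ → ℂ, Continuous l ∧ ∀ x, Complex.exp (l x) = f x := by
  have hsc : IsSimplyConnected (univ : Set ℝ) := by
    have : ContractibleSpace (univ : Set ℝ) := convex_univ.contractibleSpace ⟨0, mem_univ 0⟩
    exact SimplyConnectedSpace.ofContractible _
  obtain ⟨l, hl, he⟩ := Complex.exists_continuousOn_eqOn_exp_comp hsc isOpen_univ hf.continuousOn
    (by rintro ⟨x, -, hx⟩; exact h0 x hx)
  exact ⟨l, continuousOn_univ.1 hl, fun x => he (mem_univ x)⟩

/-- The map σ transports the path to all of ℝ, where a continuous logarithm exists, and its right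
inverse ρ on I brings the logarithm back. Subtracting the value at ρ 0 normalizes it to 0 at the
starting point. -/
theorem exists_isContinuationAlong_of_retract (hħ : ħ ≠ 0) (hK : K.IsSymm) (hg : g.det = 1)
    (hγ : Continuous γ) (hγ0 : γ 0 = 0) {σ ρ : ℝ → ℝ} (hσ : Continuous σ) (hσI : ∀ x, σ x ∈ I)
    (hρ : ContinuousOn ρ I) (hσρ : ∀ s ∈ I, σ (ρ s) = s) (h0I : 0 ∈ I)
    (hne : ∀ s ∈ I, disc K (g * gᵀ) (γ s) ≠ 0) : ∃ Φ, IsContinuationAlong ħ K g γ I Φ := by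
  obtain ⟨l, hl, hexp⟩ := exists_continuous_log (f := fun x => disc K (g * gᵀ) (γ (σ x)))
    (differentiable_disc.continuous.comp (hγ.comp hσ)) fun x => hne _ (hσI x)
  refine exists_isContinuationAlong_of_log hħ hK hg hγ hγ0 (l := fun s => l (ρ s) - l (ρ 0))
    ((hl.comp_continuousOn hρ).sub continuousOn_const) (sub_self _) fun s hs => ?_
  rw [Complex.exp_sub, hexp, hexp, hσρ s hs, hσρ 0 h0I, hγ0, disc_zero, div_one]

theorem exists_isContinuationAlong_Icc (hħ : ħ ≠ 0) (hK : K.IsSymm) (hg : g.det = 1)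
    (hγ : Continuous γ) (hγ0 : γ 0 = 0)
    (hne : ∀ s ∈ Icc (0 : ℝ) 1, disc K (g * gᵀ) (γ s) ≠ 0) :
    ∃ Φ, IsContinuationAlong ħ K g γ (Icc 0 1) Φ :=
  exists_isContinuationAlong_of_retract hħ hK hg hγ hγ0
    (σ := fun x => (projIcc (0 : ℝ) 1 zero_le_one x : ℝ)) (ρ := id)
    (continuous_subtype_val.comp continuous_projIcc) (fun x => Subtype.coe_prop _)
    continuousOn_id (fun s hs => by simp [projIcc_of_mem zero_le_one hs]) (by simp) hne

theorem exists_isContinuationAlong_Ico (hħ : ħ ≠ 0) (hK : K.IsSymm) (hg : g.det = 1)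
    (hγ : Continuous γ) (hγ0 : γ 0 = 0)
    (hne : ∀ s ∈ Ico (0 : ℝ) 1, disc K (g * gᵀ) (γ s) ≠ 0) :
    ∃ Φ, IsContinuationAlong ħ K g γ (Ico 0 1) Φ := by
  have hpos : ∀ x : ℝ, 0 < 1 + |x| := fun x => by positivity
  refine exists_isContinuationAlong_of_retract hħ hK hg hγ hγ0
    -- σ maps ℝ onto [0, 1), and s ↦ s / (1 - s) is its section with nonnegative values.
    (σ := fun x => |x| / (1 + |x|)) (ρ := fun s => s / (1 - s)) ?_ (fun x => ⟨?_, ?_⟩) ?_ ?_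
    (by simp) hne
  · exact continuous_abs.div (continuous_const.add continuous_abs) fun x => (hpos x).ne'
  · have := hpos x
    positivity
  · rw [div_lt_one (hpos x)]
    linarith
  · exact continuousOn_id.div (continuousOn_const.sub continuousOn_id) fun s hs => by
      have := hs.2
      exact (sub_pos.2 this).ne'
  · intro s hs
    have h1 : 0 < 1 - s := by linarith [hs.2]
    have h2 : |s / (1 - s)| = s / (1 - s) := abs_of_nonneg (div_nonneg hs.1 h1.le)
    simp only [h2]
    field_simp
    ring

/-! ### Singular points are the zeros of `disc` -/

/-- The complement of a countable set in the plane is path connected. A path avoiding all of Z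
except b, stopped when it first meets b, avoids Z until its end. -/
theorem exists_path_avoiding {Z : Set ℂ} (hZ : Z.Countable) {a b : ℂ} (ha : a ∉ Z) (hb : b ∈ Z) :
    ∃ γ : ℝ → ℂ, Continuous γ ∧ γ 0 = a ∧ γ 1 = b ∧ ∀ s ∈ Ico (0 : ℝ) 1, γ s ∉ Z := by
  have hab : a ≠ b := fun h => ha (h ▸ hb)
  have hpc : IsPathConnected (Z \ {b})ᶜ :=
    (hZ.mono sdiff_subset).isPathConnected_compl_of_one_lt_rank (by simp)
  obtain ⟨p, hp⟩ := hpc.joinedIn a (fun h => ha h.1) b (fun h => h.2 rfl)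
  set T : Set ℝ := {s | s ∈ Icc (0 : ℝ) 1 ∧ p.extend s = b} with hT
  have hTc : IsCompact T :=
    isCompact_Icc.inter_right (isClosed_singleton.preimage p.continuous_extend)
  have hTne : T.Nonempty := ⟨1, by simp [hT]⟩
  have hmem := hTc.sInf_mem hTne
  set m := sInf T
  have hm0 : 0 < m := by
    refine lt_of_le_of_ne hmem.1.1 fun h => hab ?_
    rw [← hmem.2, ← h, Path.extend_zero]
  refine ⟨fun s => p.extend (m * s), p.continuous_extend.comp (by fun_prop), by simp,
    by simpa using hmem.2, fun s hs hsZ => ?_⟩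
  have hms : m * s < m := by nlinarith [hs.2]
  have hI : m * s ∈ Icc (0 : ℝ) 1 := ⟨mul_nonneg hm0.le hs.1, hms.le.trans hmem.1.2⟩
  have hnb : p.extend (m * s) ≠ b := fun h =>
    absurd (csInf_le hTc.bddBelow ⟨hI, h⟩) (not_le.2 hms)
  have := hp ⟨m * s, hI⟩
  change p.extend (m * s) ∈ Z at hsZ
  rw [Path.extend_apply p hI] at hsZ hnb
  exact this ⟨hsZ, hnb⟩

/-- Away from the zeros of `disc` the continuation always extends to the end point. At a zero it
cannot, and countability of the zeros provides a path that meets them only at its end. -/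
theorem singularPoints_eq (hħ : ħ ≠ 0) (hK : K.IsSymm) (hg : g.det = 1)
    (hZ : {t | disc K (g * gᵀ) t = 0}.Countable) :
    singularPoints ħ K g = {t | disc K (g * gᵀ) t = 0} := by
  ext t₀
  constructor
  · rintro ⟨γ, hγ, hγ0, rfl, ⟨Φ, hΦ⟩, hnot⟩
    by_contra hne
    refine hnot (exists_isContinuationAlong_Icc hħ hK hg hγ hγ0 fun s hs => ?_)
    rcases hs.2.lt_or_eq with h | rfl
    · exact hΦ.disc_ne_zero hħ hK hg isPreconnected_Ico (by simp) hγ hγ0 s ⟨hs.1, h⟩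
    · exact hne
  · intro h0
    obtain ⟨γ, hγ, hγ0, hγ1, hav⟩ := exists_path_avoiding hZ (a := 0) (by simp [disc_zero]) h0
    refine ⟨γ, hγ, hγ0, hγ1, exists_isContinuationAlong_Ico hħ hK hg hγ hγ0 hav, ?_⟩
    rintro ⟨Φ, hΦ⟩
    refine hΦ.disc_ne_zero hħ hK hg isPreconnected_Icc (by simp) hγ hγ0 1 (by simp) ?_
    rw [hγ1]
    exact h0

/-! ### Zeros and square root of the factor cos t - κ sin t -/

/-- The factor of `disc` that belongs to an eigenvalue `κ` of `K P`. -/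
def fac (κ t : ℂ) : ℂ := Complex.cos t - κ * Complex.sin t

section Factor

variable {κ t : ℂ}

theorem differentiable_fac : Differentiable ℂ (fac κ) := by
  unfold fac
  fun_prop

theorem fac_add_pi : fac κ (t + Real.pi) = -fac κ t := by
  simp only [fac, Complex.cos_add_pi, Complex.sin_add_pi]
  ring

theorem fac_sub_pi : fac κ (t - Real.pi) = -fac κ t := by
  simp only [fac, Complex.cos_sub_pi, Complex.sin_sub_pi]
  ring

/-- Both zeros have the same cotangent κ, so sin(t' - t) = 0. -/
theorem exists_int_of_fac_eq_zero {t' : ℂ} (h : fac κ t = 0) (h' : fac κ t' = 0) :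
    ∃ n : ℤ, t' = t + n * Real.pi := by
  have hs : Complex.sin (t' - t) = 0 := by
    rw [fac, sub_eq_zero] at h h'
    rw [Complex.sin_sub, h, h']
    ring
  obtain ⟨n, hn⟩ := Complex.sin_eq_zero_iff.1 hs
  exact ⟨n, by rw [← hn]; ring⟩

theorem countable_fac_eq_zero (κ : ℂ) : {t | fac κ t = 0}.Countable := by
  by_cases h : ∃ t, fac κ t = 0
  · obtain ⟨t, ht⟩ := h
    refine (countable_range fun n : ℤ => t + n * Real.pi).mono fun t' ht' => ?_
    obtain ⟨n, hn⟩ := exists_int_of_fac_eq_zero ht ht'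
    exact ⟨n, hn.symm⟩
  · push Not at h
    have : {t | fac κ t = 0} = ∅ := by
      ext t
      simp [h t]
    rw [this]
    exact countable_empty

theorem sq_ne_neg_one_of_fac_eq_zero (h : fac κ t = 0) : κ ^ 2 ≠ -1 := by
  intro hκ
  rw [fac, sub_eq_zero] at h
  have := Complex.sin_sq_add_cos_sq t
  rw [h, mul_pow, hκ] at this
  simp at this

theorem exists_fac_eq_zero (hκ : κ ^ 2 ≠ -1) : ∃ t, fac κ t = 0 := by
  have h1 : 1 + Complex.I * κ ≠ 0 := fun h => hκ (by
    linear_combination (1 - Complex.I * κ) * h + κ ^ 2 * Complex.I_sq)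
  have h2 : 1 - Complex.I * κ ≠ 0 := fun h => hκ (by
    linear_combination (1 + Complex.I * κ) * h + κ ^ 2 * Complex.I_sq)
  -- In terms of x = e^{it} the factor is ((1 + iκ)x + (1 - iκ)x⁻¹) / 2, so the equation is x² = -(1
  -- - iκ)/(1 + iκ), with w = 2it.
  obtain ⟨w, hw⟩ : ∃ w, Complex.exp w = -(1 - Complex.I * κ) / (1 + Complex.I * κ) :=
    ⟨_, Complex.exp_log (div_ne_zero (neg_ne_zero.2 h2) h1)⟩
  refine ⟨-Complex.I * (w / 2), ?_⟩
  have e1 : -Complex.I * (w / 2) * Complex.I = w / 2 := by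
    linear_combination (-(w / 2)) * Complex.I_sq
  have e2 : Complex.exp (w / 2) * Complex.exp (w / 2) = Complex.exp w := by
    rw [← Complex.exp_add]
    ring_nf
  have e3 : Complex.exp (w / 2) * Complex.exp (-(w / 2)) = 1 := by
    rw [← Complex.exp_add, add_neg_cancel, Complex.exp_zero]
  have hx : Complex.exp (w / 2) ≠ 0 := Complex.exp_ne_zero _
  rw [fac, Complex.cos, Complex.sin, show -(-Complex.I * (w / 2)) * Complex.I = -(w / 2) by
    rw [neg_mul, e1], e1]
  rw [eq_div_iff h1] at hw
  refine mul_left_cancel₀ hx ?_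
  linear_combination (1 + Complex.I * κ) / 2 * e2 + (1 - Complex.I * κ) / 2 * e3 + hw / 2

/-- This is the imaginary part of cot t = κ, namely Im κ = -sinh y cosh y / |sin t|² with y = Im t.
Thus N = |sin t|² / cosh y, which is positive because sin t and cos t have no common zero. -/
theorem exists_sinh_im_eq (h : fac κ t = 0) : ∃ N > 0, Real.sinh t.im = -(κ.im * N) := by
  have hsin : Complex.sin t = ((Real.sin t.re * Real.cosh t.im : ℝ) : ℂ) +
      ((Real.cos t.re * Real.sinh t.im : ℝ) : ℂ) * Complex.I := by
    rw [Complex.sin_eq]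
    push_cast
    rfl
  have hcos : Complex.cos t = ((Real.cos t.re * Real.cosh t.im : ℝ) : ℂ) -
      ((Real.sin t.re * Real.sinh t.im : ℝ) : ℂ) * Complex.I := by
    rw [Complex.cos_eq]
    push_cast
    rfl
  rw [fac, sub_eq_zero, hcos, hsin, Complex.ext_iff] at h
  simp only [Complex.sub_re, Complex.sub_im, Complex.add_re, Complex.add_im, Complex.mul_re,
    Complex.mul_im, Complex.ofReal_re, Complex.ofReal_im, Complex.I_re, Complex.I_im, mul_zero,
    mul_one, sub_zero, zero_sub, add_zero, zero_add] at h
  obtain ⟨h1, h2⟩ := h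
  have hch := Real.cosh_pos t.im
  have hcs := Real.sin_sq_add_cos_sq t.re
  have hN0 : 0 ≤ (Real.sin t.re * Real.cosh t.im) ^ 2 + (Real.cos t.re * Real.sinh t.im) ^ 2 := by
    positivity
  have hN : 0 < (Real.sin t.re * Real.cosh t.im) ^ 2 + (Real.cos t.re * Real.sinh t.im) ^ 2 := by
    refine lt_of_le_of_ne hN0 fun h0 => ?_
    have a1 : Real.sin t.re * Real.cosh t.im = 0 := by nlinarith
    have a2 : Real.cos t.re * Real.sinh t.im = 0 := by nlinarith
    rw [a1, a2] at h1
    have a3 : Real.cos t.re = 0 := by simpa [hch.ne'] using h1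
    have a4 : Real.sin t.re = 0 := by simpa [hch.ne'] using a1
    rw [a3, a4] at hcs
    norm_num at hcs
  refine ⟨((Real.sin t.re * Real.cosh t.im) ^ 2 + (Real.cos t.re * Real.sinh t.im) ^ 2) /
    Real.cosh t.im, by positivity, ?_⟩
  field_simp
  linear_combination (-Real.sinh t.im * Real.cosh t.im) * hcs -
    Real.sin t.re * Real.cosh t.im * h2 + Real.cos t.re * Real.sinh t.im * h1

theorem im_pos_of_fac_eq_zero (h : fac κ t = 0) (hκ : κ.im < 0) : 0 < t.im := by
  obtain ⟨N, hN, hs⟩ := exists_sinh_im_eq h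
  rw [← Real.sinh_pos_iff, hs]
  nlinarith

theorem im_neg_of_fac_eq_zero (h : fac κ t = 0) (hκ : 0 < κ.im) : t.im < 0 := by
  obtain ⟨N, hN, hs⟩ := exists_sinh_im_eq h
  rw [← Real.sinh_neg_iff, hs]
  nlinarith

/-- For real κ the factor is real on [0, π] and changes from 1 to -1. -/
theorem exists_real_fac_eq_zero (hκ : κ.im = 0) : ∃ x ∈ Icc (0 : ℝ) Real.pi, fac κ x = 0 := by
  have hc : ContinuousOn (fun x : ℝ => Real.cos x - κ.re * Real.sin x) (Icc 0 Real.pi) := by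
    fun_prop
  have := intermediate_value_Icc' Real.pi_pos.le hc
  obtain ⟨x, hx, h0⟩ := this (show (0 : ℝ) ∈ Icc _ _ by simp)
  refine ⟨x, hx, ?_⟩
  have hκ' : κ = (κ.re : ℂ) := Complex.ext rfl (by simp [hκ])
  rw [fac, hκ', ← Complex.ofReal_cos, ← Complex.ofReal_sin, ← Complex.ofReal_mul,
    ← Complex.ofReal_sub]
  exact_mod_cast h0

/-- A holomorphic square root of the factor near `[0, π]`. -/
theorem exists_sqrt_fac {e : ℝ} (he : e ^ 2 = 1) (hκ : e * κ.im < 0) :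
    ∃ (V : Set ℂ) (q : ℂ → ℂ), IsOpen V ∧ (∀ x ∈ Icc (0 : ℝ) Real.pi, (x : ℂ) ∈ V) ∧
      DifferentiableOn ℂ q V ∧ (∀ t ∈ V, q t ^ 2 = fac κ t ∧ q t ≠ 0) ∧ q 0 = 1 ∧
      q Real.pi = e * Complex.I := by
  have he' : (e : ℂ) ^ 2 = 1 := by exact_mod_cast he
  have he0 : (e : ℂ) ≠ 0 := fun h => by simp [h] at he'
  -- On [0, π] the imaginary part of the factor is -Im κ sin x, of sign e in the interior.
  -- Multiplication by -ei turns this half-plane into the right one and sends the ends 1 and -1 to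
  -- -ei and ei, so the principal logarithm applies throughout. The rotation is undone by adding
  -- log(ei) = eπi/2.
  set w : ℂ → ℂ := fun t => -(e * Complex.I) * fac κ t with hw
  have hwd : Differentiable ℂ w := differentiable_fac.const_mul _
  have hlog : ∀ e' : ℝ, e' ^ 2 = 1 → Complex.log (e' * Complex.I) = e' * (Real.pi / 2 * Complex.I) := by
    intro e' he'
    rcases mul_self_eq_one_iff.1 ((sq e').symm.trans he') with rfl | rfl
    · simp [Complex.log_I]
    · simp [Complex.log_neg_I]
  refine ⟨{t | w t ∈ Complex.slitPlane},
    fun t => Complex.exp ((Complex.log (w t) + e * (Real.pi / 2 * Complex.I)) / 2),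
    Complex.isOpen_slitPlane.preimage hwd.continuous, ?_, ?_, ?_, ?_, ?_⟩
  · intro x hx
    have hre : (w x).re = -(e * κ.im) * Real.sin x := by
      simp [hw, fac, ← Complex.ofReal_cos, ← Complex.ofReal_sin]
      ring
    have hs := Real.sin_nonneg_of_mem_Icc hx
    rw [mem_ofPred_eq, Complex.mem_slitPlane_iff, hre]
    rcases hs.eq_or_lt with h0 | hpos
    · right
      have hcos : Real.cos x ≠ 0 := fun h => by
        have := Real.sin_sq_add_cos_sq x
        rw [← h0, h] at this
        norm_num at this
      have him : (w x).im = -e * Real.cos x := by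
        simp [hw, fac, ← Complex.ofReal_cos, ← Complex.ofReal_sin, ← h0]
      rw [him]
      have : e ≠ 0 := by exact_mod_cast he0
      simp [this, hcos]
    · left
      nlinarith
  · intro t ht
    exact (((((hwd t).clog ht).add_const _).div_const 2).cexp).differentiableWithinAt
  · intro t ht
    refine ⟨?_, Complex.exp_ne_zero _⟩
    have hw0 : w t ≠ 0 := Complex.slitPlane_ne_zero ht
    rw [← Complex.exp_nat_mul, Nat.cast_ofNat, mul_div_cancel₀ _ (two_ne_zero), Complex.exp_add,
      Complex.exp_log hw0, ← hlog e he, Complex.exp_log (by simp [he0])]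
    simp only [hw]
    linear_combination (-(e : ℂ) ^ 2 * fac κ t) * Complex.I_sq + fac κ t * he'
  · have h0 : w 0 = ((-e : ℝ) : ℂ) * Complex.I := by simp [hw, fac]
    simp only [h0]
    rw [hlog (-e) (by simpa using he)]
    simp
  · have h0 : w Real.pi = (e : ℂ) * Complex.I := by simp [hw, fac]
    simp only [h0]
    rw [hlog e he, ← two_mul, mul_div_cancel_left₀ _ two_ne_zero, ← hlog e he, Complex.exp_log]
    simp [he0]

end Factor

/-! ### Value at π and position of the singular points in terms of the eigenvalues -/

variable {ħ : ℝ} {K g : Matrix (Fin 2) (Fin 2) ℂ} {κ₁ κ₂ : ℂ}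

theorem disc_eq_fac_mul_fac {P : Matrix (Fin 2) (Fin 2) ℂ} (h₁ : κ₁ + κ₂ = (K * P).trace)
    (h₂ : κ₁ * κ₂ = K.det) (t : ℂ) : disc K P t = fac κ₁ t * fac κ₂ t := by
  rw [disc, ← h₁, ← h₂, fac, fac]
  ring

theorem exists_add_mul_eq (τ δ : ℂ) : ∃ κ₁ κ₂ : ℂ, κ₁ + κ₂ = τ ∧ κ₁ * κ₂ = δ := by
  obtain ⟨w, hw⟩ := IsAlgClosed.exists_pow_nat_eq (τ ^ 2 - 4 * δ) (two_pos)
  exact ⟨(τ + w) / 2, (τ - w) / 2, by ring, by linear_combination -hw / 4⟩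

theorem StarExpEq.unique {t : ℂ} {f₁ f₂ : Symbol} (hf₁ : StarExpEq ħ K g t f₁)
    (hf₂ : StarExpEq ħ K g t f₂) : f₁ = f₂ := by
  obtain ⟨Φ, hΦ, rfl⟩ := hf₁
  obtain ⟨Ψ, hΨ, rfl⟩ := hf₂
  have h := hΦ.eventually_eq isPreconnected_Icc (by simp) (by fun_prop) (by simp) hΨ 1 (by simp)
  simpa using h.self_of_nhds

theorem StarExpEq.disc_ne_zero {f : Symbol} (hħ : ħ ≠ 0) (hK : K.IsSymm) (hg : g.det = 1)
    (hf : StarExpEq ħ K g Real.pi f) {x : ℝ} (hx : x ∈ Icc (0 : ℝ) Real.pi) :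
    disc K (g * gᵀ) x ≠ 0 := by
  obtain ⟨Φ, hΦ, -⟩ := hf
  have hpi := Real.pi_pos
  have h := hΦ.disc_ne_zero hħ hK hg isPreconnected_Icc (by simp) (by fun_prop) (by simp)
    (x / Real.pi) ⟨div_nonneg hx.1 hpi.le, (div_le_one hpi).2 hx.2⟩
  rw [← Complex.ofReal_mul, div_mul_cancel₀ _ hpi.ne'] at h
  exact h

/-- A real eigenvalue would put a zero of `disc` on the segment of continuation. -/
theorem StarExpEq.im_ne_zero {f : Symbol} (hħ : ħ ≠ 0) (hK : K.IsSymm) (hg : g.det = 1)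
    (h₁ : κ₁ + κ₂ = (K * (g * gᵀ)).trace) (h₂ : κ₁ * κ₂ = K.det)
    (hf : StarExpEq ħ K g Real.pi f) : κ₁.im ≠ 0 ∧ κ₂.im ≠ 0 := by
  constructor <;> intro h <;> obtain ⟨x, hx, h0⟩ := exists_real_fac_eq_zero h <;>
  · apply hf.disc_ne_zero hħ hK hg hx
    rw [disc_eq_fac_mul_fac h₁ h₂, h0]
    simp

/-- The product of the two square roots of the factors ends at e₁i · e₂i, and the exponent vanishes
at π. A single solution, holomorphic near [0, π], serves as the germ at every point of the segment.
-/
theorem starExpEq_pi (hħ : ħ ≠ 0) (hK : K.IsSymm) (hg : g.det = 1)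
    (h₁ : κ₁ + κ₂ = (K * (g * gᵀ)).trace) (h₂ : κ₁ * κ₂ = K.det) {e₁ e₂ : ℝ} (he₁ : e₁ ^ 2 = 1)
    (he₂ : e₂ ^ 2 = 1) (hκ₁ : e₁ * κ₁.im < 0) (hκ₂ : e₂ * κ₂.im < 0) :
    StarExpEq ħ K g Real.pi (fun _ => -(e₁ * e₂ : ℂ)) := by
  obtain ⟨V₁, q₁, hV₁, hI₁, hd₁, hq₁, hz₁, hp₁⟩ := exists_sqrt_fac he₁ hκ₁
  obtain ⟨V₂, q₂, hV₂, hI₂, hd₂, hq₂, hz₂, hp₂⟩ := exists_sqrt_fac he₂ hκ₂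
  have he₁' : (e₁ : ℂ) ^ 2 = 1 := by exact_mod_cast he₁
  have he₂' : (e₂ : ℂ) ^ 2 = 1 := by exact_mod_cast he₂
  set r : ℂ → ℂ := fun t => (q₁ t * q₂ t)⁻¹ with hr
  have hsol : ∀ x ∈ Icc (0 : ℝ) Real.pi, IsLocalSolution ħ K g x (gaussian ħ K (g * gᵀ) r) := by
    intro x hx
    refine isLocalSolution_gaussian hħ hK hg (hV₁.inter hV₂) ?_ ?_ ⟨hI₁ x hx, hI₂ x hx⟩
    · exact ((hd₁.mono inter_subset_left).mul (hd₂.mono inter_subset_right)).inv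
        fun t ht => mul_ne_zero (hq₁ t ht.1).2 (hq₂ t ht.2).2
    · intro t ht
      have a₁ := (hq₁ t ht.1).2
      have a₂ := (hq₂ t ht.2).2
      rw [disc_eq_fac_mul_fac h₁ h₂, ← (hq₁ t ht.1).1, ← (hq₂ t ht.2).1]
      simp only [hr]
      field_simp
  refine ⟨fun _ => gaussian ħ K (g * gᵀ) r, ⟨?_, ?_, ?_⟩, ?_⟩
  · intro u
    simp [gaussian, expo, hr, hz₁, hz₂]
  · intro s hs
    have hx : s * Real.pi ∈ Icc (0 : ℝ) Real.pi :=
      ⟨mul_nonneg hs.1 Real.pi_pos.le, mul_le_of_le_one_left Real.pi_pos.le hs.2⟩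
    simpa using hsol _ hx
  · exact fun s _ => Eventually.of_forall fun _ => Eventually.of_forall fun _ => rfl
  · ext u
    have hI : ((e₁ : ℂ) * Complex.I * (e₂ * Complex.I))⁻¹ = -(e₁ * e₂) := by
      refine inv_eq_of_mul_eq_one_right ?_
      linear_combination (-(e₁ : ℂ) ^ 2 * e₂ ^ 2) * Complex.I_sq + e₂ ^ 2 * he₁' + he₂'
    simp [gaussian, expo, hr, hp₁, hp₂, ← hI, mul_comm]

theorem mem_singularPoints_iff (hħ : ħ ≠ 0) (hK : K.IsSymm) (hg : g.det = 1)
    (h₁ : κ₁ + κ₂ = (K * (g * gᵀ)).trace) (h₂ : κ₁ * κ₂ = K.det) (t : ℂ) :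
    t ∈ singularPoints ħ K g ↔ fac κ₁ t = 0 ∨ fac κ₂ t = 0 := by
  have hZ : {t | disc K (g * gᵀ) t = 0} = {t | fac κ₁ t = 0} ∪ {t | fac κ₂ t = 0} := by
    ext t
    simp [disc_eq_fac_mul_fac h₁ h₂]
  rw [singularPoints_eq hħ hK hg (hZ ▸ (countable_fac_eq_zero κ₁).union (countable_fac_eq_zero κ₂)),
    hZ]
  rfl

theorem starExpEq_cases (hħ : ħ ≠ 0) (hK : K.IsSymm) (hg : g.det = 1)
    (h₁ : κ₁ + κ₂ = (K * (g * gᵀ)).trace) (h₂ : κ₁ * κ₂ = K.det) :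
    (κ₁.im < 0 → κ₂.im < 0 → StarExpEq ħ K g Real.pi (fun _ => -1)) ∧
    (0 < κ₁.im → 0 < κ₂.im → StarExpEq ħ K g Real.pi (fun _ => -1)) ∧
    (κ₁.im < 0 → 0 < κ₂.im → StarExpEq ħ K g Real.pi (fun _ => 1)) ∧
    (0 < κ₁.im → κ₂.im < 0 → StarExpEq ħ K g Real.pi (fun _ => 1)) := by
  refine ⟨fun a b => ?_, fun a b => ?_, fun a b => ?_, fun a b => ?_⟩
  · simpa using starExpEq_pi hħ hK hg h₁ h₂ (e₁ := 1) (e₂ := 1) (by simp) (by simp)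
      (by linarith) (by linarith)
  · simpa using starExpEq_pi hħ hK hg h₁ h₂ (e₁ := -1) (e₂ := -1) (by simp) (by simp)
      (by linarith) (by linarith)
  · simpa using starExpEq_pi hħ hK hg h₁ h₂ (e₁ := 1) (e₂ := -1) (by simp) (by simp)
      (by linarith) (by linarith)
  · simpa using starExpEq_pi hħ hK hg h₁ h₂ (e₁ := -1) (e₂ := 1) (by simp) (by simp)
      (by linarith) (by linarith)

theorem one_ne_neg_one_symbol : (fun _ => 1 : Symbol) ≠ fun _ => -1 := fun h => by
  have := congrFun h 0
  norm_num at this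

/-- Value `-1` and singular points in the upper half-plane only. -/
theorem upper_iff (hħ : ħ ≠ 0) (hK : K.IsSymm) (hg : g.det = 1)
    (h₁ : κ₁ + κ₂ = (K * (g * gᵀ)).trace) (h₂ : κ₁ * κ₂ = K.det) :
    StarExpEq ħ K g Real.pi (fun _ => -1) ∧ SingularPointsInUpper ħ K g ↔
      (κ₁.im < 0 ∧ κ₂.im < 0) ∧ (κ₁ ^ 2 ≠ -1 ∨ κ₂ ^ 2 ≠ -1) := by
  have hmem := mem_singularPoints_iff hħ hK hg h₁ h₂
  obtain ⟨c₁, -, c₃, c₄⟩ := starExpEq_cases hħ hK hg h₁ h₂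
  constructor
  · rintro ⟨hE, ⟨t, ht⟩, hup⟩
    obtain ⟨n₁, n₂⟩ := hE.im_ne_zero hħ hK hg h₁ h₂
    refine ⟨?_, ((hmem t).1 ht).imp sq_ne_neg_one_of_fac_eq_zero sq_ne_neg_one_of_fac_eq_zero⟩
    rcases n₁.lt_or_gt with a | a <;> rcases n₂.lt_or_gt with b | b
    · exact ⟨a, b⟩
    · exact absurd ((c₃ a b).unique hE) one_ne_neg_one_symbol
    · exact absurd ((c₄ a b).unique hE) one_ne_neg_one_symbol
    · exfalso
      have := hup t ht
      rcases (hmem t).1 ht with h | h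
      · exact absurd this (im_neg_of_fac_eq_zero h a).not_gt
      · exact absurd this (im_neg_of_fac_eq_zero h b).not_gt
  · rintro ⟨⟨a, b⟩, hn⟩
    refine ⟨c₁ a b, ?_, fun t ht => ?_⟩
    · rcases hn with h | h <;> obtain ⟨t, ht⟩ := exists_fac_eq_zero h
      exacts [⟨t, (hmem t).2 (Or.inl ht)⟩, ⟨t, (hmem t).2 (Or.inr ht)⟩]
    · rcases (hmem t).1 ht with h | h
      exacts [im_pos_of_fac_eq_zero h a, im_pos_of_fac_eq_zero h b]

/-- Value `-1` and singular points in the lower half-plane only. -/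
theorem lower_iff (hħ : ħ ≠ 0) (hK : K.IsSymm) (hg : g.det = 1)
    (h₁ : κ₁ + κ₂ = (K * (g * gᵀ)).trace) (h₂ : κ₁ * κ₂ = K.det) :
    StarExpEq ħ K g Real.pi (fun _ => -1) ∧ SingularPointsInLower ħ K g ↔
      (0 < κ₁.im ∧ 0 < κ₂.im) ∧ (κ₁ ^ 2 ≠ -1 ∨ κ₂ ^ 2 ≠ -1) := by
  have hmem := mem_singularPoints_iff hħ hK hg h₁ h₂
  obtain ⟨-, c₂, c₃, c₄⟩ := starExpEq_cases hħ hK hg h₁ h₂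
  constructor
  · rintro ⟨hE, ⟨t, ht⟩, hlow⟩
    obtain ⟨n₁, n₂⟩ := hE.im_ne_zero hħ hK hg h₁ h₂
    refine ⟨?_, ((hmem t).1 ht).imp sq_ne_neg_one_of_fac_eq_zero sq_ne_neg_one_of_fac_eq_zero⟩
    rcases n₁.lt_or_gt with a | a <;> rcases n₂.lt_or_gt with b | b
    · exfalso
      have := hlow t ht
      rcases (hmem t).1 ht with h | h
      · exact absurd this (im_pos_of_fac_eq_zero h a).not_gt
      · exact absurd this (im_pos_of_fac_eq_zero h b).not_gt
    · exact absurd ((c₃ a b).unique hE) one_ne_neg_one_symbol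
    · exact absurd ((c₄ a b).unique hE) one_ne_neg_one_symbol
    · exact ⟨a, b⟩
  · rintro ⟨⟨a, b⟩, hn⟩
    refine ⟨c₂ a b, ?_, fun t ht => ?_⟩
    · rcases hn with h | h <;> obtain ⟨t, ht⟩ := exists_fac_eq_zero h
      exacts [⟨t, (hmem t).2 (Or.inl ht)⟩, ⟨t, (hmem t).2 (Or.inr ht)⟩]
    · rcases (hmem t).1 ht with h | h
      exacts [im_neg_of_fac_eq_zero h a, im_neg_of_fac_eq_zero h b]

/-- Each factor contributes exactly one line, because its zeros differ by integer multiples of π.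
The eigenvalue in the lower half-plane gives the upper line, and conversely. -/
theorem between_of_im (hħ : ħ ≠ 0) (hK : K.IsSymm) (hg : g.det = 1)
    (h₁ : κ₁ + κ₂ = (K * (g * gᵀ)).trace) (h₂ : κ₁ * κ₂ = K.det) (a : κ₁.im < 0) (b : 0 < κ₂.im)
    (n₁ : κ₁ ^ 2 ≠ -1) (n₂ : κ₂ ^ 2 ≠ -1) : RealAxisBetweenSingularLines ħ K g := by
  have hmem := mem_singularPoints_iff hħ hK hg h₁ h₂
  obtain ⟨t₁, ht₁⟩ := exists_fac_eq_zero n₁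
  obtain ⟨t₂, ht₂⟩ := exists_fac_eq_zero n₂
  have him : ∀ {κ t t' : ℂ}, fac κ t = 0 → fac κ t' = 0 → t'.im = t.im := by
    intro κ t t' h h'
    obtain ⟨n, rfl⟩ := exists_int_of_fac_eq_zero h h'
    simp
  have hper : ∀ t ∈ singularPoints ħ K g,
      t + (Real.pi : ℂ) ∈ singularPoints ħ K g ∧ t - (Real.pi : ℂ) ∈ singularPoints ħ K g := by
    intro t ht
    simpa only [hmem, fac_add_pi, fac_sub_pi, neg_eq_zero, and_self] using ht
  refine ⟨t₂.im, t₁.im, im_neg_of_fac_eq_zero ht₂ b, im_pos_of_fac_eq_zero ht₁ a,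
    ⟨⟨t₂, (hmem _).2 (Or.inr ht₂), rfl⟩, fun t ht _ => hper t ht⟩,
    ⟨⟨t₁, (hmem _).2 (Or.inl ht₁), rfl⟩, fun t ht _ => hper t ht⟩, fun t ht => ?_⟩
  rcases (hmem t).1 ht with h | h
  exacts [Or.inr (him ht₁ h), Or.inl (him ht₂ h)]

/-- Value `1` and the real axis between two lines of singular points. -/
theorem between_iff (hħ : ħ ≠ 0) (hK : K.IsSymm) (hg : g.det = 1)
    (h₁ : κ₁ + κ₂ = (K * (g * gᵀ)).trace) (h₂ : κ₁ * κ₂ = K.det) :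
    StarExpEq ħ K g Real.pi (fun _ => 1) ∧ RealAxisBetweenSingularLines ħ K g ↔
      κ₁.im * κ₂.im < 0 ∧ κ₁ ^ 2 ≠ -1 ∧ κ₂ ^ 2 ≠ -1 := by
  have hmem := mem_singularPoints_iff hħ hK hg h₁ h₂
  obtain ⟨-, -, c₃, c₄⟩ := starExpEq_cases hħ hK hg h₁ h₂
  constructor
  · rintro ⟨hE, x, y, hx, hy, ⟨⟨s, hs, rfl⟩, -⟩, ⟨⟨t, ht, rfl⟩, -⟩, -⟩
    obtain ⟨n₁, n₂⟩ := hE.im_ne_zero hħ hK hg h₁ h₂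
    have hlow : ∀ {κ : ℂ}, fac κ s = 0 → ¬ κ.im < 0 := fun h a =>
      (im_pos_of_fac_eq_zero h a).not_gt hx
    have hup : ∀ {κ : ℂ}, fac κ t = 0 → ¬ 0 < κ.im := fun h a =>
      (im_neg_of_fac_eq_zero h a).not_gt hy
    rw [hmem] at hs ht
    rcases n₁.lt_or_gt with a | a <;> rcases n₂.lt_or_gt with b | b
    · exact (hs.elim (fun h => hlow h a) fun h => hlow h b).elim
    · have e₁ : fac κ₁ t = 0 := ht.resolve_right fun h => hup h b
      have e₂ : fac κ₂ s = 0 := hs.resolve_left fun h => hlow h a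
      exact ⟨mul_neg_of_neg_of_pos a b, sq_ne_neg_one_of_fac_eq_zero e₁,
        sq_ne_neg_one_of_fac_eq_zero e₂⟩
    · have e₁ : fac κ₁ s = 0 := hs.resolve_right fun h => hlow h b
      have e₂ : fac κ₂ t = 0 := ht.resolve_left fun h => hup h a
      exact ⟨mul_neg_of_pos_of_neg a b, sq_ne_neg_one_of_fac_eq_zero e₁,
        sq_ne_neg_one_of_fac_eq_zero e₂⟩
    · exact (ht.elim (fun h => hup h a) fun h => hup h b).elim
  · rintro ⟨hlt, n₁, n₂⟩
    rcases mul_neg_iff.1 hlt with ⟨a, b⟩ | ⟨a, b⟩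
    · exact ⟨c₄ a b, between_of_im hħ hK hg (by rw [add_comm, h₁]) (by rw [mul_comm, h₂]) b a n₂ n₁⟩
    · exact ⟨c₃ a b, between_of_im hħ hK hg h₁ h₂ a b n₁ n₂⟩

/-! ### Position of the eigenvalues in terms of trace and determinant -/

/-- The sign of this function tells whether the roots of `x² - τ x + δ` are on different sides of
the real axis. -/
def rootDisc (δ τ : ℂ) : ℝ := δ.re * τ.im ^ 2 - δ.im * τ.re * τ.im + δ.im ^ 2

section Roots

variable {κ₁ κ₂ τ δ : ℂ}

theorem rootDisc_eq (h₁ : κ₁ + κ₂ = τ) (h₂ : κ₁ * κ₂ = δ) :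
    rootDisc δ τ = -(κ₁.im * κ₂.im) * ((κ₁.re - κ₂.re) ^ 2 + (κ₁.im + κ₂.im) ^ 2) := by
  subst h₁ h₂
  simp only [rootDisc, Complex.add_re, Complex.add_im, Complex.mul_re, Complex.mul_im]
  ring

/-- The cofactor is |κ₁ - κ̄₂|². It could vanish only for κ₂ = κ̄₁, which would make δ = |κ₁|² real.
-/
theorem exists_pos_rootDisc_eq (h₁ : κ₁ + κ₂ = τ) (h₂ : κ₁ * κ₂ = δ) (hδ : δ.im ≠ 0) :
    ∃ N > 0, rootDisc δ τ = -(κ₁.im * κ₂.im) * N := by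
  refine ⟨_, ?_, rootDisc_eq h₁ h₂⟩
  refine lt_of_le_of_ne (by positivity) fun h => hδ ?_
  have a₁ : κ₁.re - κ₂.re = 0 := by nlinarith
  have a₂ : κ₁.im + κ₂.im = 0 := by nlinarith
  rw [← h₂, Complex.mul_im]
  linear_combination κ₁.re * a₂ - κ₁.im * a₁

theorem rootDisc_pos_iff (h₁ : κ₁ + κ₂ = τ) (h₂ : κ₁ * κ₂ = δ) (hδ : δ.im ≠ 0) :
    0 < rootDisc δ τ ↔ κ₁.im * κ₂.im < 0 := by
  obtain ⟨N, hN, h⟩ := exists_pos_rootDisc_eq h₁ h₂ hδ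
  rw [h, mul_pos_iff_of_pos_right hN, neg_pos]

theorem rootDisc_neg_iff (h₁ : κ₁ + κ₂ = τ) (h₂ : κ₁ * κ₂ = δ) (hδ : δ.im ≠ 0) :
    rootDisc δ τ < 0 ↔ 0 < κ₁.im * κ₂.im := by
  obtain ⟨N, hN, h⟩ := exists_pos_rootDisc_eq h₁ h₂ hδ
  rw [h, neg_mul, neg_lt_zero, mul_pos_iff_of_pos_right hN]

theorem im_neg_iff (h₁ : κ₁ + κ₂ = τ) (h₂ : κ₁ * κ₂ = δ) (hδ : δ.im ≠ 0) :
    rootDisc δ τ < 0 ∧ τ.im < 0 ↔ κ₁.im < 0 ∧ κ₂.im < 0 := by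
  rw [rootDisc_neg_iff h₁ h₂ hδ, ← h₁, Complex.add_im]
  constructor
  · rintro ⟨h, hs⟩
    rcases mul_pos_iff.1 h with ⟨a, b⟩ | h
    · linarith
    · exact h
  · rintro ⟨a, b⟩
    exact ⟨mul_pos_of_neg_of_neg a b, by linarith⟩

theorem im_pos_iff (h₁ : κ₁ + κ₂ = τ) (h₂ : κ₁ * κ₂ = δ) (hδ : δ.im ≠ 0) :
    rootDisc δ τ < 0 ∧ 0 < τ.im ↔ 0 < κ₁.im ∧ 0 < κ₂.im := by
  rw [rootDisc_neg_iff h₁ h₂ hδ, ← h₁, Complex.add_im]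
  constructor
  · rintro ⟨h, hs⟩
    rcases mul_pos_iff.1 h with h | ⟨a, b⟩
    · exact h
    · linarith
  · rintro ⟨a, b⟩
    exact ⟨mul_pos a b, by linarith⟩

theorem sq_ne_neg_one_and_iff (h₁ : κ₁ + κ₂ = τ) (h₂ : κ₁ * κ₂ = δ) :
    κ₁ ^ 2 ≠ -1 ∧ κ₂ ^ 2 ≠ -1 ↔ τ ^ 2 + (1 - δ) ^ 2 ≠ 0 := by
  have h : τ ^ 2 + (1 - δ) ^ 2 = (κ₁ ^ 2 + 1) * (κ₂ ^ 2 + 1) := by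
    rw [← h₁, ← h₂]
    ring
  rw [h, mul_ne_zero_iff, Ne, Ne, Ne, Ne, add_eq_zero_iff_eq_neg, add_eq_zero_iff_eq_neg]

/-- If both squares were -1, then δ² = 1 and δ would be real. So singular points always exist in the
generic case. -/
theorem sq_ne_neg_one_or (h₂ : κ₁ * κ₂ = δ) (hδ : δ.im ≠ 0) : κ₁ ^ 2 ≠ -1 ∨ κ₂ ^ 2 ≠ -1 := by
  by_contra! h
  have : δ * δ = 1 := by
    rw [← h₂]
    linear_combination κ₂ ^ 2 * h.1 - h.2
  rcases mul_self_eq_one_iff.1 this with rfl | rfl <;> simp at hδ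

end Roots

/-! ### Real coordinates on the sphere of symmetric special unitary matrices -/

section Sphere

/-- The points of the sphere `S̃²` in real coordinates. -/
def sphereMatrix (v : Fin 3 → ℝ) : Matrix (Fin 2) (Fin 2) ℂ :=
  !![v 0 + v 1 * Complex.I, v 2 * Complex.I; v 2 * Complex.I, v 0 - v 1 * Complex.I]

theorem dotProduct_fin_three (v w : Fin 3 → ℝ) : v ⬝ᵥ w = v 0 * w 0 + v 1 * w 1 + v 2 * w 2 := by
  simp [dotProduct, Fin.sum_univ_three]

theorem isSymm_sphereMatrix (v : Fin 3 → ℝ) : (sphereMatrix v).IsSymm := by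
  ext i j
  fin_cases i <;> fin_cases j <;> simp [sphereMatrix]

theorem det_sphereMatrix (v : Fin 3 → ℝ) : (sphereMatrix v).det = ((v ⬝ᵥ v : ℝ) : ℂ) := by
  rw [sphereMatrix, Matrix.det_fin_two_of, dotProduct_fin_three]
  push_cast
  linear_combination (-(v 1 : ℂ) ^ 2 - (v 2 : ℂ) ^ 2) * Complex.I_sq

theorem sphereMatrix_mem_sphere {v : Fin 3 → ℝ} (hv : v ⬝ᵥ v = 1) : sphereMatrix v ∈ sphere := by
  refine ⟨Matrix.mem_specialUnitaryGroup_iff.2 ⟨?_, by rw [det_sphereMatrix, hv]; simp⟩,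
    isSymm_sphereMatrix v⟩
  rw [Matrix.mem_unitaryGroup_iff]
  have hv' : (v 0 : ℂ) * v 0 + v 1 * v 1 + v 2 * v 2 = 1 := by
    rw [dotProduct_fin_three] at hv
    exact_mod_cast hv
  have hI := Complex.I_sq
  ext i j
  fin_cases i <;> fin_cases j <;>
    simp [sphereMatrix, Matrix.mul_apply, Fin.sum_univ_two, Matrix.star_apply]
  · linear_combination hv' - ((v 1 : ℂ) ^ 2 + (v 2 : ℂ) ^ 2) * hI
  · ring
  · ring
  · linear_combination hv' - ((v 1 : ℂ) ^ 2 + (v 2 : ℂ) ^ 2) * hI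

/-- For a unitary matrix of determinant 1, the adjoint is the adjugate. Together with symmetry this
makes the off-diagonal entry purely imaginary and the diagonal entries conjugate. -/
theorem exists_sphereMatrix_eq {P : Matrix (Fin 2) (Fin 2) ℂ} (hP : P ∈ sphere) :
    ∃ v : Fin 3 → ℝ, v ⬝ᵥ v = 1 ∧ P = sphereMatrix v := by
  obtain ⟨hU, hS⟩ := hP
  obtain ⟨hU, hdet⟩ := Matrix.mem_specialUnitaryGroup_iff.1 hU
  have hadj : star P = P.adjugate := by
    have h1 : star P * P = 1 := Matrix.mem_unitaryGroup_iff'.1 hU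
    calc star P = star P * (P * P.adjugate) := by rw [Matrix.mul_adjugate, hdet]; simp
      _ = P.adjugate := by rw [← Matrix.mul_assoc, h1, one_mul]
  have h00 := congrFun (congrFun hadj 0) 0
  have h01 := congrFun (congrFun hadj 0) 1
  rw [Matrix.adjugate_fin_two] at h00 h01
  simp [Matrix.star_apply] at h00 h01
  have hs : P 1 0 = P 0 1 := hS.apply 0 1
  rw [hs] at h01
  have hre : (P 0 1).re = 0 := by
    have := congrArg Complex.re h01
    simp at this
    linarith
  have hP' : P = sphereMatrix ![(P 0 0).re, (P 0 0).im, (P 0 1).im] := by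
    have e01 : P 0 1 = (P 0 1).im * Complex.I := by
      conv_lhs => rw [← Complex.re_add_im (P 0 1), hre]
      simp
    have e11 : P 1 1 = (P 0 0).re - (P 0 0).im * Complex.I := by
      rw [← h00]
      exact Complex.ext (by simp) (by simp)
    ext i j
    fin_cases i <;> fin_cases j
    · simp [sphereMatrix]
    · simpa [sphereMatrix] using e01
    · simpa [sphereMatrix, hs] using e01
    · simpa [sphereMatrix] using e11
  refine ⟨_, ?_, hP'⟩
  rw [hP', det_sphereMatrix] at hdet
  exact_mod_cast hdet

theorem exists_unit_orthogonal (p q : Fin 3 → ℝ) :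
    ∃ v : Fin 3 → ℝ, v ⬝ᵥ v = 1 ∧ v ⬝ᵥ p = 0 ∧ v ⬝ᵥ q = 0 := by
  let f : (Fin 3 → ℝ) →ₗ[ℝ] (Fin 2 → ℝ) := Matrix.toLin' (Matrix.of ![p, q])
  obtain ⟨v, hv, hv0⟩ : ∃ v ∈ f.ker, v ≠ 0 :=
    (Submodule.ne_bot_iff _).1 (LinearMap.ker_ne_bot_of_finrank_lt (f := f) (by simp))
  have hvp : v ⬝ᵥ p = 0 ∧ v ⬝ᵥ q = 0 := by
    rw [LinearMap.mem_ker] at hv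
    have h0 := congrFun hv 0
    have h1 := congrFun hv 1
    simp [f, Matrix.toLin'_apply, Matrix.mulVec] at h0 h1
    rw [dotProduct_comm v p, dotProduct_comm v q]
    exact ⟨h0, h1⟩
  have hpos : 0 < v ⬝ᵥ v := by
    refine lt_of_le_of_ne ?_ fun h => hv0 (dotProduct_self_eq_zero.1 h.symm)
    rw [dotProduct_fin_three]
    nlinarith [sq_nonneg (v 0), sq_nonneg (v 1), sq_nonneg (v 2)]
  refine ⟨(Real.sqrt (v ⬝ᵥ v))⁻¹ • v, ?_, ?_, ?_⟩
  · rw [smul_dotProduct, dotProduct_smul, smul_eq_mul, smul_eq_mul, ← mul_assoc, ← mul_inv,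
      Real.mul_self_sqrt hpos.le, inv_mul_cancel₀ hpos.ne']
  · rw [smul_dotProduct, hvp.1, smul_zero]
  · rw [smul_dotProduct, hvp.2, smul_zero]

/-- Any two points of the unit sphere lie on a common great circle. -/
theorem exists_great_circle {v v' : Fin 3 → ℝ} (hv : v ⬝ᵥ v = 1) (hv' : v' ⬝ᵥ v' = 1) :
    ∃ (w : Fin 3 → ℝ) (φ : ℝ), w ⬝ᵥ w = 1 ∧ w ⬝ᵥ v = 0 ∧ v' = Real.cos φ • v + Real.sin φ • w := by
  set c := v' ⬝ᵥ v with hc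
  have hd : (v' - c • v) ⬝ᵥ (v' - c • v) = 1 - c ^ 2 := by
    simp only [sub_dotProduct, dotProduct_sub, smul_dotProduct, dotProduct_smul, hv, hv',
      dotProduct_comm v v', ← hc, smul_eq_mul]
    ring
  have hd0 : 0 ≤ 1 - c ^ 2 := by
    rw [← hd, dotProduct_fin_three]
    nlinarith [sq_nonneg ((v' - c • v) 0), sq_nonneg ((v' - c • v) 1), sq_nonneg ((v' - c • v) 2)]
  have hcos : Real.cos (Real.arccos c) = c := Real.cos_arccos (by nlinarith) (by nlinarith)
  have hsin : Real.sin (Real.arccos c) = Real.sqrt (1 - c ^ 2) := Real.sin_arccos c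
  -- If c² = 1 then v' = ±v, and any unit vector orthogonal to v will do. Otherwise w is the
  -- normalized component of v' orthogonal to v.
  rcases hd0.eq_or_lt with h0 | hpos
  · obtain ⟨w, hw, hwv, -⟩ := exists_unit_orthogonal v v
    refine ⟨w, Real.arccos c, hw, hwv, ?_⟩
    rw [hcos, hsin, ← h0, Real.sqrt_zero, zero_smul, add_zero, ← sub_eq_zero]
    exact dotProduct_self_eq_zero.1 (hd.trans h0.symm)
  · have hs := Real.sqrt_pos.2 hpos
    refine ⟨(Real.sqrt (1 - c ^ 2))⁻¹ • (v' - c • v), Real.arccos c, ?_, ?_, ?_⟩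
    · rw [smul_dotProduct, dotProduct_smul, smul_eq_mul, smul_eq_mul, ← mul_assoc, ← mul_inv,
        Real.mul_self_sqrt hpos.le, hd, inv_mul_cancel₀ hpos.ne']
    · rw [smul_dotProduct, sub_dotProduct, smul_dotProduct, hv, ← hc]
      simp
    · rw [hcos, hsin, smul_smul, mul_inv_cancel₀ hs.ne', one_smul]
      abel

theorem sphereMatrix_lincomb (a b : ℝ) (v w : Fin 3 → ℝ) :
    sphereMatrix (a • v + b • w) = (a : ℂ) • sphereMatrix v + (b : ℂ) • sphereMatrix w := by
  ext i j
  fin_cases i <;> fin_cases j <;> simp [sphereMatrix] <;> ring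

/-- The polarization of P adj P = det P, where det P is the square of the length of the coordinate
vector. -/
theorem sphereMatrix_polarization (v w : Fin 3 → ℝ) :
    sphereMatrix w * (sphereMatrix v).adjugate + sphereMatrix v * (sphereMatrix w).adjugate =
      ((2 * (w ⬝ᵥ v) : ℝ) : ℂ) • 1 := by
  have hI := Complex.I_sq
  rw [dotProduct_fin_three]
  ext i j
  fin_cases i <;> fin_cases j <;>
    simp [sphereMatrix, Matrix.adjugate_fin_two]
  · linear_combination (-2 * ((v 1 : ℂ) * w 1 + (v 2 : ℂ) * w 2)) * hI
  · ring
  · ring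
  · linear_combination (-2 * ((v 1 : ℂ) * w 1 + (v 2 : ℂ) * w 2)) * hI

end Sphere

/-! ### Lifting great circles to 𝒮' -/

section Curve

theorem trace_sphereMatrix_mul_adjugate (v w : Fin 3 → ℝ) :
    (sphereMatrix w * (sphereMatrix v).adjugate).trace = ((2 * (w ⬝ᵥ v) : ℝ) : ℂ) := by
  rw [dotProduct_fin_three, Matrix.trace_fin_two]
  simp [sphereMatrix, Matrix.adjugate_fin_two]
  linear_combination (-2 * ((v 1 : ℂ) * w 1 + (v 2 : ℂ) * w 2)) * Complex.I_sq

theorem det_smul_one_add_smul (a b : ℂ) (N : Matrix (Fin 2) (Fin 2) ℂ) :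
    (a • (1 : Matrix (Fin 2) (Fin 2) ℂ) + b • N).det = a ^ 2 + a * b * N.trace + b ^ 2 * N.det := by
  simp [Matrix.det_fin_two, Matrix.trace_fin_two]
  ring

/-- Great circles through `g ᵗg` lift to curves through `g`. -/
theorem exists_lift_great_circle (g : SPrime) {v w : Fin 3 → ℝ} (hv : v ⬝ᵥ v = 1)
    (hw : w ⬝ᵥ w = 1) (hwv : w ⬝ᵥ v = 0) (hg : g.1.1 * g.1.1ᵀ = sphereMatrix v) :
    ∃ G : ℝ → SPrime, Continuous G ∧ G 0 = g ∧ ∀ s, (G s).1.1 * (G s).1.1ᵀ =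
      sphereMatrix (Real.cos (2 * s) • v + Real.sin (2 * s) • w) := by
  set A := sphereMatrix v with hA
  set B := sphereMatrix w with hB
  -- N = BA⁻¹ has trace 0 and determinant 1, so cos s + sin s N lies in SL(2, ℂ). As NA = B and NB =
  -- -A, its action X ↦ hX ᵗh moves A along the great circle through B at double speed.
  set N := B * A.adjugate with hN
  have hAdet : A.det = 1 := by rw [hA, det_sphereMatrix, hv]; simp
  have hBdet : B.det = 1 := by rw [hB, det_sphereMatrix, hw]; simp
  have hNdet : N.det = 1 := by rw [hN, Matrix.det_mul, Matrix.det_adjugate, hAdet, hBdet]; simp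
  have hNtr : N.trace = 0 := by
    rw [hN, hA, hB, trace_sphereMatrix_mul_adjugate, hwv]
    simp
  have hNA : N * A = B := by rw [hN, Matrix.mul_assoc, Matrix.adjugate_mul, hAdet]; simp
  have hpol : N = -(A * B.adjugate) := by
    have := sphereMatrix_polarization v w
    rw [hwv, mul_zero, Complex.ofReal_zero, zero_smul] at this
    exact eq_neg_of_add_eq_zero_left this
  have hNB : N * B = -A := by
    rw [hpol, neg_mul, Matrix.mul_assoc, Matrix.adjugate_mul, hBdet]
    simp
  have hAS : Aᵀ = A := isSymm_sphereMatrix v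
  have hBS : Bᵀ = B := isSymm_sphereMatrix w
  have hANT : A * Nᵀ = B := by rw [← hAS, ← Matrix.transpose_mul, hNA, hBS]
  have hBNT : B * Nᵀ = -A := by
    rw [← hBS, ← Matrix.transpose_mul, hNB, Matrix.transpose_neg, hAS]
  set h : ℝ → Matrix (Fin 2) (Fin 2) ℂ := fun s =>
    (Real.cos s : ℂ) • (1 : Matrix (Fin 2) (Fin 2) ℂ) + (Real.sin s : ℂ) • N with hh
  have hdet : ∀ s, (h s).det = 1 := by
    intro s
    simp only [hh]
    rw [det_smul_one_add_smul, hNtr, hNdet]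
    have := Real.cos_sq_add_sin_sq s
    have h2 : (Real.cos s : ℂ) ^ 2 + (Real.sin s : ℂ) ^ 2 = 1 := by exact_mod_cast this
    linear_combination h2
  have hprod : ∀ s, (h s * g.1.1) * (h s * g.1.1)ᵀ =
      sphereMatrix (Real.cos (2 * s) • v + Real.sin (2 * s) • w) := by
    intro s
    have e1 : (h s * g.1.1) * (h s * g.1.1)ᵀ = h s * A * (h s)ᵀ := by
      rw [Matrix.transpose_mul, ← hg]
      simp only [Matrix.mul_assoc]
    rw [e1, sphereMatrix_lincomb, ← hA, ← hB]
    have e2 : h s * A = (Real.cos s : ℂ) • A + (Real.sin s : ℂ) • B := by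
      simp only [hh, Matrix.add_mul, Matrix.smul_mul, Matrix.one_mul, hNA]
    have e3 : (h s)ᵀ = (Real.cos s : ℂ) • (1 : Matrix (Fin 2) (Fin 2) ℂ) + (Real.sin s : ℂ) • Nᵀ := by
      simp [hh]
    rw [e2, e3, Real.cos_two_mul', Real.sin_two_mul]
    simp only [Matrix.add_mul, Matrix.mul_add, Matrix.smul_mul, Matrix.mul_smul, Matrix.mul_one,
      hANT, hBNT]
    push_cast
    module
  have hcont : Continuous h := by
    simp only [hh]
    fun_prop
  let G : ℝ → SPrime := fun s => ⟨⟨h s * g.1.1, by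
    rw [Matrix.det_mul, hdet, g.1.2, one_mul]⟩, by
      change (h s * g.1.1) * (h s * g.1.1)ᵀ ∈ sphere
      rw [hprod]
      refine sphereMatrix_mem_sphere ?_
      simp only [add_dotProduct, dotProduct_add, smul_dotProduct, dotProduct_smul, hv, hw, hwv,
        dotProduct_comm v w, smul_eq_mul]
      have := Real.cos_sq_add_sin_sq (2 * s)
      linear_combination this⟩
  refine ⟨G, ?_, ?_, fun s => hprod s⟩
  · refine Continuous.subtype_mk (Continuous.subtype_mk ?_ _) _
    exact hcont.matrix_mul continuous_const
  · refine Subtype.ext (Subtype.ext ?_)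
    change h 0 * g.1.1 = g.1.1
    simp [hh]

/-- A great circle from the identity matrix reaches every point of the sphere, and it lifts from g =
1. The parameter is φ / 2 because the lift runs through the double angle. -/
theorem exists_mul_transpose_eq {v : Fin 3 → ℝ} (hv : v ⬝ᵥ v = 1) :
    ∃ g : SPrime, g.1.1 * g.1.1ᵀ = sphereMatrix v := by
  set v₀ : Fin 3 → ℝ := ![1, 0, 0] with hv₀
  have hM : sphereMatrix v₀ = 1 := by
    ext i j
    fin_cases i <;> fin_cases j <;> simp [sphereMatrix, hv₀]
  have h0 : v₀ ⬝ᵥ v₀ = 1 := by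
    rw [dotProduct_fin_three]
    simp [hv₀]
  let g₀ : SPrime := ⟨1, by
    change (1 : Matrix (Fin 2) (Fin 2) ℂ) * (1 : Matrix (Fin 2) (Fin 2) ℂ)ᵀ ∈ sphere
    simpa [hM] using sphereMatrix_mem_sphere h0⟩
  have hg₀ : g₀.1.1 * g₀.1.1ᵀ = sphereMatrix v₀ := by
    change (1 : Matrix (Fin 2) (Fin 2) ℂ) * (1 : Matrix (Fin 2) (Fin 2) ℂ)ᵀ = _
    simp [hM]
  obtain ⟨w, φ, hw, hwv, hvφ⟩ := exists_great_circle h0 hv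
  obtain ⟨G, -, -, hG⟩ := exists_lift_great_circle g₀ h0 hw hwv hg₀
  exact ⟨G (φ / 2), by rw [hG, hvφ]; congr 3 <;> ring_nf⟩

end Curve

/-! ### Values of the trace on the sphere -/

variable {K : Matrix (Fin 2) (Fin 2) ℂ}

theorem trace_mul_sphereMatrix (K : Matrix (Fin 2) (Fin 2) ℂ) (v : Fin 3 → ℝ) :
    (K * sphereMatrix v).trace = v 0 * (K 0 0 + K 1 1) + v 1 * (Complex.I * (K 0 0 - K 1 1)) +
      v 2 * (Complex.I * (K 0 1 + K 1 0)) := by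
  rw [Matrix.trace_fin_two]
  simp [sphereMatrix, Matrix.mul_apply, Fin.sum_univ_two]
  ring

theorem trace_mul_sphereMatrix_lincomb (a b : ℝ) (v w : Fin 3 → ℝ) :
    (K * sphereMatrix (a • v + b • w)).trace =
      a * (K * sphereMatrix v).trace + b * (K * sphereMatrix w).trace := by
  rw [sphereMatrix_lincomb, Matrix.mul_add, Matrix.trace_add, Matrix.mul_smul, Matrix.mul_smul,
    Matrix.trace_smul, Matrix.trace_smul, smul_eq_mul, smul_eq_mul]

/-- The trace is a complex-valued linear function on ℝ³, so a unit vector orthogonal to the real and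
imaginary parts of its coefficients annihilates it. -/
theorem exists_trace_eq_zero (K : Matrix (Fin 2) (Fin 2) ℂ) :
    ∃ v : Fin 3 → ℝ, v ⬝ᵥ v = 1 ∧ (K * sphereMatrix v).trace = 0 := by
  set c : Fin 3 → ℂ := ![K 0 0 + K 1 1, Complex.I * (K 0 0 - K 1 1), Complex.I * (K 0 1 + K 1 0)]
    with hc
  obtain ⟨v, hv, h1, h2⟩ := exists_unit_orthogonal (fun i => (c i).re) (fun i => (c i).im)
  refine ⟨v, hv, ?_⟩
  have h : (K * sphereMatrix v).trace = v 0 * c 0 + v 1 * c 1 + v 2 * c 2 := by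
    rw [trace_mul_sphereMatrix]
    simp [hc]
  rw [dotProduct_fin_three] at h1 h2
  rw [h]
  refine Complex.ext ?_ ?_
  · simpa using h1
  · simpa using h2

/-- The filled ellipse of the values of the trace contains its foci. -/
theorem exists_trace_eq (hK : K.IsSymm) {w : ℂ} (hw : w ^ 2 = 4 * K.det) (hw0 : w ≠ 0) :
    ∃ v : Fin 3 → ℝ, v ⬝ᵥ v = 1 ∧ (K * sphereMatrix v).trace = w := by
  set c : Fin 3 → ℂ := ![(K 0 0 + K 1 1) / w, Complex.I * (K 0 0 - K 1 1) / w,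
    Complex.I * (K 0 1 + K 1 0) / w] with hc
  have hs : K 1 0 = K 0 1 := hK.apply 0 1
  -- The squares of the coefficients of the trace add up to 4 det K = w². For c = p + iq this says
  -- |p|² = 1 + |q|² and p ⊥ q.
  have hcc : c 0 ^ 2 + c 1 ^ 2 + c 2 ^ 2 = 1 := by
    simp only [hc, Matrix.cons_val_zero, Matrix.cons_val_one, Matrix.cons_val, div_pow, ← add_div]
    rw [div_eq_one_iff_eq (pow_ne_zero 2 hw0), hw, Matrix.det_fin_two, hs]
    linear_combination ((K 0 0 - K 1 1) ^ 2 + (K 0 1 + K 0 1) ^ 2) * Complex.I_sq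
  obtain ⟨p, hp⟩ : ∃ p : Fin 3 → ℝ, ∀ i, p i = (c i).re := ⟨_, fun _ => rfl⟩
  obtain ⟨q, hq⟩ : ∃ q : Fin 3 → ℝ, ∀ i, q i = (c i).im := ⟨_, fun _ => rfl⟩
  have hre := congrArg Complex.re hcc
  have him := congrArg Complex.im hcc
  simp [sq, ← hp, ← hq] at hre him
  have hn : p 0 ^ 2 + p 1 ^ 2 + p 2 ^ 2 = 1 + (q 0 ^ 2 + q 1 ^ 2 + q 2 ^ 2) := by
    linear_combination hre
  have ho : p 0 * q 0 + p 1 * q 1 + p 2 * q 2 = 0 := by linear_combination him / 2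
  set n := p 0 ^ 2 + p 1 ^ 2 + p 2 ^ 2 with hn'
  have hn0 : n ≠ 0 := by
    rw [hn]
    positivity
  -- The vector is (p + p × q) / |p|². Its products with p and q are 1 and 0, and its squared length
  -- is (1 + |q|²) / |p|² = 1.
  refine ⟨![(p 0 + (p 1 * q 2 - p 2 * q 1)) / n, (p 1 + (p 2 * q 0 - p 0 * q 2)) / n,
    (p 2 + (p 0 * q 1 - p 1 * q 0)) / n], ?_, ?_⟩
  · rw [dotProduct_fin_three]
    simp only [Matrix.cons_val_zero, Matrix.cons_val_one, Matrix.cons_val]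
    field_simp
    have hq2 : q 0 ^ 2 + q 1 ^ 2 + q 2 ^ 2 = n - 1 := by linear_combination -hn
    have hlag : (p 1 * q 2 - p 2 * q 1) ^ 2 + (p 2 * q 0 - p 0 * q 2) ^ 2 +
        (p 0 * q 1 - p 1 * q 0) ^ 2 = n * (q 0 ^ 2 + q 1 ^ 2 + q 2 ^ 2) -
          (p 0 * q 0 + p 1 * q 1 + p 2 * q 2) ^ 2 := by
      rw [hn']
      ring
    rw [ho, hq2] at hlag
    linear_combination hlag - hn'
  · have h : ∀ v : Fin 3 → ℝ, (K * sphereMatrix v).trace =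
        w * (v 0 * c 0 + v 1 * c 1 + v 2 * c 2) := by
      intro v
      rw [trace_mul_sphereMatrix]
      simp [hc]
      field_simp
    rw [h, mul_eq_left₀ hw0]
    simp only [Matrix.cons_val_zero, Matrix.cons_val_one, Matrix.cons_val]
    refine Complex.ext ?_ ?_
    · simp [← hp, ← hq, -Complex.ofReal_add, -Complex.ofReal_sub, -Complex.ofReal_mul, -Complex.ofReal_div]
      field_simp
      rw [hn']
      ring
    · simp [← hp, ← hq, -Complex.ofReal_add, -Complex.ofReal_sub, -Complex.ofReal_mul, -Complex.ofReal_div]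
      field_simp
      linear_combination ho

/-- The trace of `K g ᵗg`. -/
def traceParam (K : Matrix (Fin 2) (Fin 2) ℂ) (g : SPrime) : ℂ := (K * (g.1.1 * g.1.1ᵀ)).trace

theorem continuous_traceParam (K : Matrix (Fin 2) (Fin 2) ℂ) : Continuous (traceParam K) := by
  have h : Continuous fun g : SPrime => g.1.1 :=
    continuous_subtype_val.comp continuous_subtype_val
  exact (continuous_const.matrix_mul (h.matrix_mul h.matrix_transpose)).matrix_trace

theorem continuous_rootDisc (δ : ℂ) : Continuous (rootDisc δ) := by
  unfold rootDisc
  fun_prop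

/-! ### Density of the nonexceptional elements -/

/-- A real polynomial whose zeros are the exceptional values of the trace. -/
def excDisc (δ : ℂ) (X Y : ℝ) : ℝ :=
  (δ.re * Y ^ 2 - δ.im * X * Y + δ.im ^ 2) *
    ((X ^ 2 - Y ^ 2 + ((1 - δ) ^ 2).re) ^ 2 + (2 * X * Y + ((1 - δ) ^ 2).im) ^ 2)

theorem excDisc_ne_zero_iff (δ τ : ℂ) :
    excDisc δ τ.re τ.im ≠ 0 ↔ rootDisc δ τ ≠ 0 ∧ τ ^ 2 + (1 - δ) ^ 2 ≠ 0 := by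
  have h : (τ.re ^ 2 - τ.im ^ 2 + ((1 - δ) ^ 2).re) ^ 2 +
      (2 * τ.re * τ.im + ((1 - δ) ^ 2).im) ^ 2 = Complex.normSq (τ ^ 2 + (1 - δ) ^ 2) := by
    rw [Complex.normSq_apply, Complex.add_re, Complex.add_im, sq τ, Complex.mul_re, Complex.mul_im]
    ring
  rw [excDisc, h, mul_ne_zero_iff, Ne, Ne, Ne, Ne, Complex.normSq_eq_zero]
  rfl

/-- Along the great circle the polynomial is real analytic in s. If it vanished near 0, it would
vanish everywhere, in particular at s = φ / 2. -/
theorem frequently_excDisc_ne_zero {δ τ₀ τ₁ : ℂ} {φ : ℝ}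
    (h : excDisc δ (Real.cos φ * τ₀.re + Real.sin φ * τ₁.re)
      (Real.cos φ * τ₀.im + Real.sin φ * τ₁.im) ≠ 0) :
    ∃ᶠ s in 𝓝 (0 : ℝ), excDisc δ (Real.cos (2 * s) * τ₀.re + Real.sin (2 * s) * τ₁.re)
      (Real.cos (2 * s) * τ₀.im + Real.sin (2 * s) * τ₁.im) ≠ 0 := by
  intro hev
  have han : AnalyticOnNhd ℝ (fun s : ℝ =>
      excDisc δ (Real.cos (2 * s) * τ₀.re + Real.sin (2 * s) * τ₁.re)
      (Real.cos (2 * s) * τ₀.im + Real.sin (2 * s) * τ₁.im)) univ := by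
    intro s _
    unfold excDisc
    fun_prop
  have h0 := han.eqOn_zero_of_preconnected_of_eventuallyEq_zero isPreconnected_univ (mem_univ 0)
    (hev.mono fun s hs => not_not.1 hs)
  refine h ?_
  have := h0 (mem_univ (φ / 2))
  simpa [mul_div_cancel₀] using this

variable {K : Matrix (Fin 2) (Fin 2) ℂ}

theorem mem_closure_excDisc_ne_zero (hK : K.det.im ≠ 0) (g : SPrime) :
    g ∈ closure {g : SPrime | excDisc K.det (traceParam K g).re (traceParam K g).im ≠ 0} := by
  obtain ⟨v, hv, hg⟩ := exists_sphereMatrix_eq g.2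
  obtain ⟨v', hv', h0⟩ := exists_trace_eq_zero K
  obtain ⟨w, φ, hw, hwv, hφ⟩ := exists_great_circle hv hv'
  obtain ⟨G, hGc, hG0, hG⟩ := exists_lift_great_circle g hv hw hwv hg
  have hne : excDisc K.det (Real.cos φ * ((K * sphereMatrix v).trace).re +
      Real.sin φ * ((K * sphereMatrix w).trace).re) (Real.cos φ * ((K * sphereMatrix v).trace).im +
      Real.sin φ * ((K * sphereMatrix w).trace).im) ≠ 0 := by
    rw [hφ, trace_mul_sphereMatrix_lincomb] at h0
    have hre := congrArg Complex.re h0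
    have him := congrArg Complex.im h0
    rw [Complex.add_re, Complex.re_ofReal_mul, Complex.re_ofReal_mul] at hre
    rw [Complex.add_im, Complex.im_ofReal_mul, Complex.im_ofReal_mul] at him
    rw [hre, him, excDisc_ne_zero_iff]
    -- At τ = 0 the two conditions read (Im δ)² ≠ 0 and (1 - δ)² ≠ 0, and both follow from Im δ ≠ 0.
    refine ⟨by simpa [rootDisc] using hK, ?_⟩
    rw [zero_pow two_ne_zero, zero_add]
    refine pow_ne_zero 2 fun h => hK ?_
    rw [← sub_eq_zero.1 h, Complex.one_im]
  have hfreq := frequently_excDisc_ne_zero hne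
  refine mem_closure_iff_frequently.2 ?_
  have ht : Tendsto G (𝓝 0) (𝓝 g) := hG0 ▸ hGc.tendsto 0
  refine ht.frequently (hfreq.mono fun s hs => ?_)
  have hτ : traceParam K (G s) = Real.cos (2 * s) * (K * sphereMatrix v).trace +
      Real.sin (2 * s) * (K * sphereMatrix w).trace := by
    rw [traceParam, hG, trace_mul_sphereMatrix_lincomb]
  simp only [mem_ofPred_eq, hτ, Complex.add_re, Complex.re_ofReal_mul, Complex.add_im,
    Complex.im_ofReal_mul]
  exact hs

theorem exists_traceParam_eq_zero (K : Matrix (Fin 2) (Fin 2) ℂ) :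
    ∃ g : SPrime, traceParam K g = 0 := by
  obtain ⟨v, hv, h0⟩ := exists_trace_eq_zero K
  obtain ⟨g, hg⟩ := exists_mul_transpose_eq hv
  exact ⟨g, by rw [traceParam, hg, h0]⟩

theorem exists_traceParam_eq (hK : K.IsSymm) {w : ℂ} (hw : w ^ 2 = 4 * K.det) (hw0 : w ≠ 0) :
    ∃ g : SPrime, traceParam K g = w := by
  obtain ⟨v, hv, h0⟩ := exists_trace_eq hK hw hw0
  obtain ⟨g, hg⟩ := exists_mul_transpose_eq hv
  exact ⟨g, by rw [traceParam, hg, h0]⟩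

/-- This is the case of a double eigenvalue κ₁ = κ₂ = w/2, whose imaginary part is nonzero because
κ₁² = δ is not real. Taking both w and -w then realizes both signs of Im τ. -/
theorem rootDisc_neg_of_sq_eq {δ w : ℂ} (hw : w ^ 2 = 4 * δ) (hδ : δ.im ≠ 0) :
    w.im ≠ 0 ∧ rootDisc δ w < 0 := by
  have h₁ : w / 2 + w / 2 = w := by ring
  have h₂ : w / 2 * (w / 2) = δ := by linear_combination hw / 4
  have him : w.im ≠ 0 := fun h => hδ (by
    have := congrArg Complex.im hw
    simp [sq, h] at this
    exact this)
  refine ⟨him, (rootDisc_neg_iff h₁ h₂ hδ).2 ?_⟩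
  rw [← sq]
  have : (w / 2).im ≠ 0 := by simpa using him
  positivity

theorem exists_traceParam_im (hK : K.IsSymm) (hδ : K.det.im ≠ 0) :
    (∃ g : SPrime, rootDisc K.det (traceParam K g) < 0 ∧ (traceParam K g).im < 0) ∧
    ∃ g : SPrime, rootDisc K.det (traceParam K g) < 0 ∧ 0 < (traceParam K g).im := by
  obtain ⟨w, hw⟩ := IsAlgClosed.exists_pow_nat_eq (4 * K.det) two_pos
  have hw' : (-w) ^ 2 = 4 * K.det := by rw [neg_sq, hw]
  obtain ⟨him, hr⟩ := rootDisc_neg_of_sq_eq hw hδ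
  obtain ⟨him', hr'⟩ := rootDisc_neg_of_sq_eq hw' hδ
  have hw0 : w ≠ 0 := fun h => him (by simp [h])
  obtain ⟨g, hg⟩ := exists_traceParam_eq hK hw hw0
  obtain ⟨g', hg'⟩ := exists_traceParam_eq hK hw' (neg_ne_zero.2 hw0)
  rcases him.lt_or_gt with h | h
  · exact ⟨⟨g, by rwa [hg], by rwa [hg]⟩, ⟨g', by rwa [hg'], by rw [hg', Complex.neg_im]; linarith⟩⟩
  · exact ⟨⟨g', by rwa [hg'], by rw [hg', Complex.neg_im]; linarith⟩, ⟨g, by rwa [hg], by rwa [hg]⟩⟩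

/-! ### Generic expression parameters and conclusion -/

/-- The generic expression parameters. -/
def genericParam : Set ExprParam := {K | K.1.det.im ≠ 0}

theorem isOpen_genericParam : IsOpen genericParam :=
  isOpen_ne.preimage (Complex.continuous_im.comp continuous_subtype_val.matrix_det)

theorem dense_genericParam : Dense genericParam := by
  intro K
  by_cases hK : K.1.det.im ≠ 0
  · exact subset_closure hK
  rw [not_not] at hK
  -- Along diag(1, i) the imaginary part of the determinant, zero at s = 0, becomes s(b + s). The
  -- coefficient of s² is Im(1 · i) = 1, so it is nonzero for all small s ≠ 0.
  let M : ℝ → ExprParam := fun s => ⟨K.1 + (s : ℂ) • Matrix.diagonal ![1, Complex.I],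
    K.2.add ((Matrix.isSymm_diagonal _).smul _)⟩
  have hMc : Continuous M := Continuous.subtype_mk (by fun_prop) _
  have hM0 : M 0 = K := Subtype.ext (by simp [M])
  have hdet : ∀ s, (M s).1.det.im = s * ((K.1 1 1).im + (K.1 0 0).re + s) := by
    intro s
    have h := hK
    rw [Matrix.det_fin_two] at h ⊢
    simp [M] at h ⊢
    linear_combination h
  have ht : Tendsto M (𝓝[≠] 0) (𝓝 K) := (hM0 ▸ hMc.tendsto 0).mono_left nhdsWithin_le_nhds
  refine mem_closure_of_tendsto ht ?_
  set b := (K.1 1 1).im + (K.1 0 0).re with hb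
  have hev : ∀ᶠ s in 𝓝[≠] (0 : ℝ), b + s ≠ 0 := by
    by_cases hb0 : b = 0
    · filter_upwards [self_mem_nhdsWithin] with s hs
      rw [hb0, zero_add]
      exact hs
    · have : ContinuousAt (fun s : ℝ => b + s) 0 := by fun_prop
      exact (this.eventually_ne (by simpa using hb0)).filter_mono nhdsWithin_le_nhds
  filter_upwards [self_mem_nhdsWithin, hev] with s hs hs'
  change (M s).1.det.im ≠ 0
  rw [hdet]
  exact mul_ne_zero hs hs'

end

end WeylStar

open WeylStar in
theorem mainTheorem11 (ħ : ℝ) (hħ : 0 < ħ) :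
    ∃ 𝒢 : Set ExprParam, IsOpen 𝒢 ∧ Dense 𝒢 ∧
      ∀ K ∈ 𝒢, ∃ S₀ Sp Sm : Set SPrime,
        (IsOpen S₀ ∧ IsOpen Sp ∧ IsOpen Sm) ∧
        (S₀.Nonempty ∧ Sp.Nonempty ∧ Sm.Nonempty) ∧
        (Disjoint S₀ Sp ∧ Disjoint S₀ Sm ∧ Disjoint Sp Sm) ∧
        closure (S₀ ∪ Sp ∪ Sm) = Set.univ ∧
        (∀ g : SPrime, g ∈ S₀ ↔
          StarExpEq ħ K.1 g.1.1 (Real.pi : ℂ) (fun _ => 1) ∧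
            RealAxisBetweenSingularLines ħ K.1 g.1.1) ∧
        (∀ g : SPrime, g ∈ Sp ↔
          StarExpEq ħ K.1 g.1.1 (Real.pi : ℂ) (fun _ => -1) ∧
            SingularPointsInUpper ħ K.1 g.1.1) ∧
        (∀ g : SPrime, g ∈ Sm ↔
          StarExpEq ħ K.1 g.1.1 (Real.pi : ℂ) (fun _ => -1) ∧
            SingularPointsInLower ħ K.1 g.1.1) := by
  refine ⟨genericParam, isOpen_genericParam, dense_genericParam, fun K hK => ?_⟩
  have hδ : K.1.det.im ≠ 0 := hK
  have hτ := continuous_traceParam K.1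
  have hr := (continuous_rootDisc K.1.det).comp hτ
  have hi := Complex.continuous_im.comp hτ
  -- Only the first set has to exclude eigenvalues ±i, since both lines of singular points must be
  -- present there. In the other two sets one eigenvalue may be ±i, and the other still gives
  -- singular points.
  refine ⟨{g | 0 < rootDisc K.1.det (traceParam K.1 g) ∧
      traceParam K.1 g ^ 2 + (1 - K.1.det) ^ 2 ≠ 0},
    {g | rootDisc K.1.det (traceParam K.1 g) < 0 ∧ (traceParam K.1 g).im < 0},
    {g | rootDisc K.1.det (traceParam K.1 g) < 0 ∧ 0 < (traceParam K.1 g).im},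
    ⟨(isOpen_lt continuous_const hr).inter
        (isOpen_ne_fun ((hτ.pow 2).add continuous_const) continuous_const),
      (isOpen_lt hr continuous_const).inter (isOpen_lt hi continuous_const),
      (isOpen_lt hr continuous_const).inter (isOpen_lt continuous_const hi)⟩,
    ⟨?_, (exists_traceParam_im K.2 hδ).1, (exists_traceParam_im K.2 hδ).2⟩,
    ⟨?_, ?_, ?_⟩, ?_, fun g => ?_, fun g => ?_, fun g => ?_⟩
  · obtain ⟨g, hg⟩ := exists_traceParam_eq_zero K.1
    have h1 : (1 : ℂ) - K.1.det ≠ 0 := fun h => hδ (by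
      rw [← sub_eq_zero.1 h, Complex.one_im])
    refine ⟨g, ?_, ?_⟩
    · rw [hg]
      have h2 : rootDisc K.1.det 0 = K.1.det.im ^ 2 := by simp [rootDisc]
      rw [h2]
      positivity
    · rw [hg]
      simpa using h1
  · exact Set.disjoint_left.2 fun g hg hg' => hg.1.not_gt hg'.1
  · exact Set.disjoint_left.2 fun g hg hg' => hg.1.not_gt hg'.1
  · exact Set.disjoint_left.2 fun g hg hg' => hg.2.not_gt hg'.2
  · refine Set.eq_univ_of_forall fun g => ?_
    refine closure_mono ?_ (mem_closure_excDisc_ne_zero hδ g)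
    intro g hg
    obtain ⟨h1, h2⟩ := (excDisc_ne_zero_iff _ _).1 hg
    rcases h1.lt_or_gt with h | h
    -- For real τ one has `rootDisc δ τ` = (Im δ)² ≥ 0, so a negative value forces Im τ ≠ 0.
    · have him : (traceParam K.1 g).im ≠ 0 := fun h0 => by
        simp only [rootDisc, h0] at h
        nlinarith [sq_nonneg K.1.det.im]
      rcases him.lt_or_gt with h' | h'
      · exact Or.inl (Or.inr ⟨h, h'⟩)
      · exact Or.inr ⟨h, h'⟩
    · exact Or.inl (Or.inl ⟨h, h2⟩)
  · obtain ⟨κ₁, κ₂, h₁, h₂⟩ := exists_add_mul_eq (traceParam K.1 g) K.1.det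
    rw [between_iff hħ.ne' K.2 g.1.2 h₁ h₂, ← rootDisc_pos_iff h₁ h₂ hδ,
      sq_ne_neg_one_and_iff h₁ h₂]
    rfl
  · obtain ⟨κ₁, κ₂, h₁, h₂⟩ := exists_add_mul_eq (traceParam K.1 g) K.1.det
    rw [upper_iff hħ.ne' K.2 g.1.2 h₁ h₂, ← im_neg_iff h₁ h₂ hδ,
      and_iff_left (sq_ne_neg_one_or h₂ hδ)]
    rfl
  · obtain ⟨κ₁, κ₂, h₁, h₂⟩ := exists_add_mul_eq (traceParam K.1 g) K.1.det
    rw [lower_iff hħ.ne' K.2 g.1.2 h₁ h₂, ← im_pos_iff h₁ h₂ hδ,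
      and_iff_left (sq_ne_neg_one_or h₂ hδ)]
    rfl
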